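/- Let $\Gamma$ be a compact metric graph: a finite graph with edge set $\mathcal E$, $E=|\mathcal E|$, in which every edge $e$ joins two distinct vertices and is identified with an interval $[0,l_e]$, $0<l_e<\infty$. Let $D_\Gamma=\bigcup_{e_1,e_2\in\mathcal E}(0,l_{e_1})\times(0,l_{e_2})$ (disjoint union) be the two-particle configuration space, $L^2(D_\Gamma)=\bigoplus_{e_1,e_2}L^2((0,l_{e_1})\times(0,l_{e_2}))$ (complex-valued functions), and $H^1(D_\Gamma)=\bigoplus_{e_1,e_2}H^1((0,l_{e_1})\times(0,l_{e_2}))$. For $\psi=(\psi_{e_1e_2})\in H^1(D_\Gamma)$ and $y\in[0,1]$ let $\psi_{bv}(y)\in\mathbb C^{4E^2}$ be the vector of boundary values (traces) with the components $$\sqrt{l_{e_2}}\,\psi_{e_1e_2}(0,l_{e_2}y),\quad \sqrt{l_{e_2}}\,\psi_{e_1e_2}(l_{e_1},l_{e_2}y),\quad \sqrt{l_{e_1}}\,\psi_{e_1e_2}(l_{e_1}y,0),\quad \sqrt{l_{e_1}}\,\psi_{e_1e_2}(l_{e_1}y,l_{e_2}),\qquad e_1,e_2\in\mathcal E .$$ Let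 $P,L:[0,1]\to \mathrm M(4E^2,\mathbb C)$ be bounded and measurable maps such that, for a.e. $y\in[0,1]$, $P(y)$ is an orthogonal projector and $L(y)$ is a self-adjoint endomorphism on $\ker P(y)$. Consider the quadratic form $$Q^{(2)}_{P,L}[\psi]=\sum_{e_1,e_2}\int_0^{l_{e_2}}\!\!\int_0^{l_{e_1}}\bigl(|\partial_x\psi_{e_1e_2}|^2+|\partial_y\psi_{e_1e_2}|^2\bigr)\,dx\,dy-\int_0^1\langle\psi_{bv}(y),L(y)\psi_{bv}(y)\rangle_{\mathbb C^{4E^2}}\,dy$$ with domain $$\mathcal D=\{\psi\in H^1(D_\Gamma):\ P(y)\psi_{bv}(y)=0\ \text{for a.e. } y\in[0,1]\}.$$ Then for every $\psi\in H^1(D_\Gamma)$ the boundary values exist for a.e. $y$, with $\psi_{bv}\in L^2(0,1)\otimes\mathbb C^{4E^2}$; $\mathcal D$ is a linear subspace of $L^2(D_\Gamma)$ on which $Q^{(2)}_{P,L}$ is a quadratic form, induced by a Hermitian sesquilinear form; and $Q^{(2)}_{P,L}$ with domain $\mathcal D$ is bounded from below and closed. -/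

import Mathlib

open MeasureTheory Set Filter Topology
open scoped ContDiff ComplexConjugate Matrix

/-- A compact metric graph: every edge joins two distinct vertices (`init e` at coordinate `0`,
`term e` at coordinate `length e`) and has a finite positive length.  Several edges may join the
same pair of vertices. -/
structure CompactMetricGraph (V E : Type*) where
  init : E → V
  term : E → V
  init_ne_term : ∀ e, init e ≠ term e
  length : E → ℝ
  length_pos : ∀ e, 0 < length e

section Sobolev

/-- The open rectangle `(0, a) × (0, b)`. -/
def rect (a b : ℝ) : Set (ℝ × ℝ) := Ioo 0 a ×ˢ Ioo 0 b

/-- The complex Hilbert space `L²(U)`, for `U` a subset of the plane. -/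
abbrev L2 (U : Set (ℝ × ℝ)) : Type := Lp ℂ 2 (volume.restrict U)

/-- `v` is the weak derivative of `u` on `U` in the direction `w`. -/
def IsWeakDeriv (U : Set (ℝ × ℝ)) (w : ℝ × ℝ) (u v : L2 U) : Prop :=
  ∀ φ : ℝ × ℝ → ℝ, ContDiff ℝ ∞ φ → HasCompactSupport φ → tsupport φ ⊆ U →
    ∫ z in U, (fderiv ℝ φ z w : ℂ) * u z = -∫ z in U, (φ z : ℂ) * v z

/-- `u ∈ H¹(U)`: both weak first-order partial derivatives exist in `L²(U)`. -/
def MemH1 (U : Set (ℝ × ℝ)) (u : L2 U) : Prop :=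
  (∃ v : L2 U, IsWeakDeriv U (1, 0) u v) ∧ ∃ v : L2 U, IsWeakDeriv U (0, 1) u v

open Classical in
/-- The weak derivative of `u` in the direction `w` (for open `U` it is unique; the value is `0`
if there is none). -/
noncomputable def weakDeriv (U : Set (ℝ × ℝ)) (w : ℝ × ℝ) (u : L2 U) : L2 U :=
  if h : ∃ v : L2 U, IsWeakDeriv U w u v then h.choose else 0

end Sobolev

section TwoParticles

variable {V E : Type*}

/-- The four sides `x = 0`, `x = l₁`, `y = 0`, `y = l₂` of a rectangle `(0, l₁) × (0, l₂)`. -/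
inductive Side
  | left | right | bottom | top

instance : Fintype Side where
  elems := ⟨{.left, .right, .bottom, .top}, by simp⟩
  complete i := by cases i <;> simp

/-- The component `(e₁, e₂)` of the two-particle configuration space. -/
def CompactMetricGraph.cell (Γ : CompactMetricGraph V E) (e : E × E) : Set (ℝ × ℝ) :=
  rect (Γ.length e.1) (Γ.length e.2)

/-- The two-particle Hilbert space `L²(D)`, i.e. the Hilbert space direct sum over all pairs of
edges `(e₁, e₂)` of `L²((0, l_{e₁}) × (0, l_{e₂}))`. -/
abbrev TwoParticleSpace [Fintype E] (Γ : CompactMetricGraph V E) : Type _ :=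
  PiLp 2 (fun e : E × E => L2 (Γ.cell e))

/-- Indices of boundary values: a pair of edges and a side of the corresponding rectangle; there
are `4 |E|²` of them. -/
abbrev BVIndex (E : Type*) : Type _ := (E × E) × Side

variable [Fintype E] (Γ : CompactMetricGraph V E)

/-- `H¹(D)`: every component is in `H¹` of its rectangle. -/
def H1 : Set (TwoParticleSpace Γ) := {ψ | ∀ e, MemH1 (Γ.cell e) (ψ e)}

/-- The segment on which the component `ψ_{e₁e₂}` is followed up to the side in order to evaluate
it at the point with parameter `y ∈ [0, 1]` of that side. -/
noncomputable def sideSlice (ψ : TwoParticleSpace Γ) (i : BVIndex E) (y : ℝ) : ℝ → ℂ :=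
  match i with
  | (e, .left) => fun t => ψ e (t, Γ.length e.2 * y)
  | (e, .right) => fun t => ψ e (t, Γ.length e.2 * y)
  | (e, .bottom) => fun t => ψ e (Γ.length e.1 * y, t)
  | (e, .top) => fun t => ψ e (Γ.length e.1 * y, t)

/-- The coordinate transversal to the side tends to its value on the side from inside the
rectangle; sets of Lebesgue measure zero are disregarded, so that limits along this filter
are essential limits. -/
noncomputable def sideFilter (i : BVIndex E) : Filter ℝ :=
  match i with
  | (_, .left) => ae volume ⊓ 𝓝[>] 0
  | (e, .right) => ae volume ⊓ 𝓝[<] (Γ.length e.1)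
  | (_, .bottom) => ae volume ⊓ 𝓝[>] 0
  | (e, .top) => ae volume ⊓ 𝓝[<] (Γ.length e.2)

/-- The length of the side. -/
def sideLength (i : BVIndex E) : ℝ :=
  match i with
  | (e, .left) => Γ.length e.2
  | (e, .right) => Γ.length e.2
  | (e, .bottom) => Γ.length e.1
  | (e, .top) => Γ.length e.1

/-- All boundary values of `ψ` with parameter `y` exist, as essential limits. -/
def HasBoundaryValues (ψ : TwoParticleSpace Γ) (y : ℝ) : Prop :=
  ∀ i : BVIndex E, ∃ c : ℂ, Tendsto (sideSlice Γ ψ i y) (sideFilter Γ i) (𝓝 c)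

/-- The vector `ψ_bv(y)` of boundary values, with components
`√l₂ ψ(0, l₂ y)`, `√l₂ ψ(l₁, l₂ y)`, `√l₁ ψ(l₁ y, 0)`, `√l₁ ψ(l₁ y, l₂)`, where
`l₁ = l_{e₁}`, `l₂ = l_{e₂}`, `ψ = ψ_{e₁e₂}`. -/
noncomputable def boundaryValue (ψ : TwoParticleSpace Γ) (y : ℝ) : BVIndex E → ℂ :=
  fun i => (Real.sqrt (sideLength Γ i) : ℂ) * limUnder (sideFilter Γ i) (sideSlice Γ ψ i y)

/-- Lebesgue measure on `[0, 1]`. -/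
noncomputable abbrev unitMeasure : Measure ℝ := volume.restrict (Icc 0 1)

/-- A measurable and (essentially) bounded map from `[0, 1]` to the square matrices. -/
def IsBoundedMeasurable {ι : Type*} (A : ℝ → Matrix ι ι ℂ) : Prop :=
  (∀ i j, AEMeasurable (fun y => A y i j) unitMeasure) ∧
    ∃ C : ℝ, ∀ᵐ y ∂unitMeasure, ∀ i j, ‖A y i j‖ ≤ C

/-- The matrix `L` restricts to a self-adjoint endomorphism of `ker P`. -/
def IsSelfAdjointOnKer {ι : Type*} [Fintype ι] (P L : Matrix ι ι ℂ) : Prop :=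
  (∀ v : ι → ℂ, P *ᵥ v = 0 → P *ᵥ (L *ᵥ v) = 0) ∧
    ∀ v w : ι → ℂ, P *ᵥ v = 0 → P *ᵥ w = 0 → star v ⬝ᵥ (L *ᵥ w) = star (L *ᵥ v) ⬝ᵥ w

/-- The domain of the two-particle form: all `ψ ∈ H¹(D)` with `P(y) ψ_bv(y) = 0` for almost every
`y ∈ [0, 1]`. -/
def formDomain (P : ℝ → Matrix (BVIndex E) (BVIndex E) ℂ) : Set (TwoParticleSpace Γ) :=
  {ψ | ψ ∈ H1 Γ ∧ ∀ᵐ y ∂unitMeasure, P y *ᵥ boundaryValue Γ ψ y = 0}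

/-- The sesquilinear form `⟨∇φ, ∇ψ⟩ - ⟨φ_bv, L ψ_bv⟩` (antilinear in `φ`); the quadratic form
`Q[ψ]` is its value at `φ = ψ`. -/
noncomputable def twoParticleForm (L : ℝ → Matrix (BVIndex E) (BVIndex E) ℂ)
    (φ ψ : TwoParticleSpace Γ) : ℂ :=
  (∑ e : E × E,
    (inner ℂ (weakDeriv (Γ.cell e) (1, 0) (φ e)) (weakDeriv (Γ.cell e) (1, 0) (ψ e)) +
      inner ℂ (weakDeriv (Γ.cell e) (0, 1) (φ e)) (weakDeriv (Γ.cell e) (0, 1) (ψ e)))) -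
  ∫ y in Icc (0 : ℝ) 1, star (boundaryValue Γ φ y) ⬝ᵥ (L y *ᵥ boundaryValue Γ ψ y)

end TwoParticles

section Forms

variable {H : Type*} [NormedAddCommGroup H] [InnerProductSpace ℂ H]

/-- The set `D` is a linear subspace and `s` is a Hermitian sesquilinear form on it, so that
`ψ ↦ s ψ ψ` is a real quadratic form with domain `D`. -/
structure IsHermitianFormOn (D : Set H) (s : H → H → ℂ) : Prop where
  zero_mem : (0 : H) ∈ D
  add_mem : ∀ φ ∈ D, ∀ ψ ∈ D, φ + ψ ∈ D
  smul_mem : ∀ (c : ℂ), ∀ ψ ∈ D, c • ψ ∈ D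
  add_right : ∀ φ ∈ D, ∀ ψ ∈ D, ∀ χ ∈ D, s φ (ψ + χ) = s φ ψ + s φ χ
  smul_right : ∀ (c : ℂ), ∀ φ ∈ D, ∀ ψ ∈ D, s φ (c • ψ) = c * s φ ψ
  conj_symm : ∀ φ ∈ D, ∀ ψ ∈ D, s ψ φ = conj (s φ ψ)

/-- The quadratic form `ψ ↦ s ψ ψ` with domain `D` is bounded from below. -/
def IsSemibounded (D : Set H) (s : H → H → ℂ) : Prop :=
  ∃ c : ℝ, ∀ ψ ∈ D, c * ‖ψ‖ ^ 2 ≤ (s ψ ψ).re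

/-- The quadratic form `ψ ↦ s ψ ψ` with domain `D` is closed: whenever `uₙ ∈ D` converges to `ψ`
in `H` and `s[uₙ - uₘ] → 0` as `n, m → ∞`, then `ψ ∈ D` and `s[uₙ - ψ] → 0`. -/
def IsClosedForm (D : Set H) (s : H → H → ℂ) : Prop :=
  ∀ (u : ℕ → H) (ψ : H), (∀ n, u n ∈ D) → Tendsto u atTop (𝓝 ψ) →
    Tendsto (fun p : ℕ × ℕ => s (u p.1 - u p.2) (u p.1 - u p.2)) atTop (𝓝 0) →
    ψ ∈ D ∧ Tendsto (fun n => s (u n - ψ) (u n - ψ)) atTop (𝓝 0)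

end Forms

/-!
The whole argument rests on the absolute continuity of Sobolev functions on lines. If `f ∈ L²` has
the weak `x`-derivative `g` on the rectangle `(0, a) × (0, b)`, then for almost every `y` the slice
`f(·, y)` is almost everywhere equal to `c(y) + ∫₀ˣ g(s, y) ds`
(`HasWeakPartial.exists_ae_eq_primitive`). Indeed `f` minus the primitive of `g` annihilates all
`x`-derivatives of test functions, and a test function is such a derivative up to a product of a
fixed bump in `x` with its `x`-mean (`exists_testFunction_fderiv_eq`), so the difference is a
function of `y` alone.

Consequently the essential limits at the sides exist for almost every `y`, and averaging
`‖h(p)‖ ≤ ‖h(x)‖ + ∫ ‖h'‖` over an interval of length `δ` next to the side gives the trace inequality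
`δ ∫ ‖ψ_bv,i‖² ≤ 2 ‖ψ‖² + 2 δ² ‖∂ψ‖²` (`mul_integral_norm_boundaryValue_sq_le`). As `δ` is free, the
boundary term, whose matrix is bounded, has relative bound less than one with respect to the kinetic
energy. This yields `‖∇ψ‖² / 2 - K ‖ψ‖² ≤ Q[ψ]` on all of `H¹` (`exists_half_energy_le`), hence
semiboundedness. A sequence that converges in `L²` and is Cauchy for `Q` is therefore Cauchy in
`H¹`; its weak derivatives converge because weak differentiation is a closed operator
(`mem_H1_and_tendsto_energy`), its boundary values converge in `L²` by the trace inequality, and the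
linear condition `P ψ_bv = 0` passes to the limit (`ae_mulVec_boundaryValue_eq_zero`).
-/

/-! ### Primitives of test functions -/

/-- A compact subset of `(0, a)` keeps a positive distance from both endpoints. -/
lemma exists_pos_subset_Icc_of_isCompact {a : ℝ} {K : Set ℝ} (hK : IsCompact K)
    (h : K ⊆ Ioo 0 a) : ∃ ε > 0, K ⊆ Icc ε (a - ε) := by
  obtain ⟨δ, hδ, hsub⟩ := hK.exists_thickening_subset_open isOpen_Ioo h
  refine ⟨δ / 2, by positivity, fun x hx => ?_⟩
  have h1 : x - δ / 2 ∈ Ioo 0 a := hsub <| Metric.mem_thickening_iff.2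
    ⟨x, hx, by rw [Real.dist_eq, sub_sub_cancel_left, abs_neg, abs_of_pos] <;> linarith⟩
  have h2 : x + δ / 2 ∈ Ioo 0 a := hsub <| Metric.mem_thickening_iff.2
    ⟨x, hx, by rw [Real.dist_eq, add_sub_cancel_left, abs_of_pos] <;> linarith⟩
  exact ⟨by linarith [h1.1], by linarith [h2.2]⟩

/-- A smooth step from `0` to `1` inside `(0, a)`. -/
noncomputable def smoothStep (a x : ℝ) : ℝ := Real.smoothTransition (3 * x / a - 1)

lemma contDiff_smoothStep (a : ℝ) : ContDiff ℝ ∞ (smoothStep a) :=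
  Real.smoothTransition.contDiff.comp (by fun_prop)

lemma smoothStep_of_le {a x : ℝ} (ha : 0 < a) (h : x ≤ a / 3) : smoothStep a x = 0 := by
  refine Real.smoothTransition.zero_of_nonpos ?_
  rw [sub_nonpos, div_le_one ha]; linarith

lemma smoothStep_of_ge {a x : ℝ} (ha : 0 < a) (h : 2 * a / 3 ≤ x) : smoothStep a x = 1 := by
  refine Real.smoothTransition.one_of_one_le ?_
  rw [le_sub_iff_add_le, le_div_iff₀ ha]; linarith

/-- Parametric primitives of smooth functions that are supported in `(0, ∞)` in the integration
variable are smooth: the primitive is a convolution with the Heaviside function. -/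
lemma contDiff_parametric_primitive {φ : ℝ × ℝ → ℝ} (hφ : ContDiff ℝ ∞ φ)
    (hc : HasCompactSupport φ) (h0 : ∀ z : ℝ × ℝ, z.1 ≤ 0 → φ z = 0) :
    ContDiff ℝ ∞ (fun z : ℝ × ℝ => ∫ t in (0 : ℝ)..z.1, φ (t, z.2)) := by
  set H : ℝ → ℝ := indicator (Ici 0) fun _ => 1 with hH
  have key := contDiffOn_convolution_right_with_param_comp (μ := (volume : Measure ℝ)) (n := ⊤)
    (ContinuousLinearMap.mul ℝ ℝ)
    (s := (univ : Set (ℝ × ℝ))) (v := Prod.fst) contDiff_fst.contDiffOn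
    (f := H) (g := fun z t => φ (t, z.2)) (k := Prod.fst '' tsupport φ)
    isOpen_univ (hc.image continuous_fst)
    (fun z t _ ht => by
      by_contra hne
      exact ht ⟨(t, z.2), subset_tsupport _ hne, rfl⟩)
    ((locallyIntegrable_const 1).indicator measurableSet_Ici)
    (by
      refine ContDiff.contDiffOn ?_
      exact hφ.comp (by fun_prop : ContDiff ℝ ∞ fun p : (ℝ × ℝ) × ℝ => (p.2, p.1.2)))
  rw [contDiffOn_univ] at key
  convert key using 1
  ext z
  have hcont : Continuous fun t => φ (t, z.2) := hφ.continuous.comp (by fun_prop)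
  have hi : Integrable fun t => φ (t, z.2) := by
    refine hcont.integrable_of_hasCompactSupport ?_
    refine HasCompactSupport.intro (hc.image continuous_fst) fun t ht => ?_
    by_contra hne
    exact ht ⟨(t, z.2), subset_tsupport _ hne, rfl⟩
  rw [convolution_eq_swap, ← intervalIntegral.integral_Iic_sub_Iic hi.integrableOn hi.integrableOn,
    setIntegral_eq_zero_of_forall_eq_zero (t := Iic 0) fun t ht => h0 (t, z.2) ht, sub_zero,
    ← integral_indicator measurableSet_Iic]
  congr 1 with t
  simp only [hH, indicator, mem_Iic, mem_Ici, sub_nonneg, ContinuousLinearMap.mul_apply']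
  split_ifs <;> simp

/-- Every test function on the rectangle becomes an `x`-derivative of a test function after
subtracting a product of a fixed bump in `x` with its integral over `x`. -/
lemma exists_testFunction_fderiv_eq {a b : ℝ} (ha : 0 < a) {φ : ℝ × ℝ → ℝ}
    (hφ : ContDiff ℝ ∞ φ) (hc : HasCompactSupport φ) (hs : tsupport φ ⊆ rect a b) :
    ∃ Φ : ℝ × ℝ → ℝ, ContDiff ℝ ∞ Φ ∧ HasCompactSupport Φ ∧ tsupport Φ ⊆ rect a b ∧
      ∀ z, fderiv ℝ Φ z (1, 0) =
        φ z - deriv (smoothStep a) z.1 * ∫ t in Ioo 0 a, φ (t, z.2) := by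
  have hout : ∀ z ∉ tsupport φ, φ z = 0 := fun z hz => image_eq_zero_of_notMem_tsupport hz
  obtain ⟨ε, hε, hε'⟩ := exists_pos_subset_Icc_of_isCompact (a := a) (hc.image continuous_fst)
    (by rintro _ ⟨z, hz, rfl⟩; exact (hs hz).1)
  obtain ⟨η, hη, hη'⟩ := exists_pos_subset_Icc_of_isCompact (a := b) (hc.image continuous_snd)
    (by rintro _ ⟨z, hz, rfl⟩; exact (hs hz).2)
  have hx : ∀ z : ℝ × ℝ, z.1 ∉ Icc ε (a - ε) → φ z = 0 := fun z hz =>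
    hout z fun h => hz (hε' ⟨z, h, rfl⟩)
  have hy : ∀ z : ℝ × ℝ, z.2 ∉ Icc η (b - η) → φ z = 0 := fun z hz =>
    hout z fun h => hz (hη' ⟨z, h, rfl⟩)
  have hG := contDiff_parametric_primitive hφ hc fun z hz => hx z fun h => by linarith [h.1]
  have hcont : ∀ y, Continuous fun t => φ (t, y) := fun y => hφ.continuous.comp (by fun_prop)
  set G : ℝ × ℝ → ℝ := fun z => ∫ t in (0 : ℝ)..z.1, φ (t, z.2) with hGdef
  have hGa : ContDiff ℝ ∞ fun z : ℝ × ℝ => G (a, z.2) := hG.comp (by fun_prop)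
  have hS : ContDiff ℝ ∞ fun z : ℝ × ℝ => smoothStep a z.1 :=
    (contDiff_smoothStep a).comp contDiff_fst
  -- both terms vanish near the left side and cancel near the right side
  have hΦ : ContDiff ℝ ∞ fun z : ℝ × ℝ => G z - smoothStep a z.1 * G (a, z.2) :=
    hG.sub (hS.mul hGa)
  have hzero : ∀ z ∉ Icc (min ε (a / 3)) (max (a - ε) (2 * a / 3)) ×ˢ Icc η (b - η),
      G z - smoothStep a z.1 * G (a, z.2) = 0 := by
    intro z hz
    have hG0 : z.2 ∉ Icc η (b - η) → ∀ x, G (x, z.2) = 0 := fun h x => by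
      simp only [hGdef]
      rw [intervalIntegral.integral_congr (g := fun _ => 0) fun t _ => hy (t, z.2) h]
      simp
    by_cases h2 : z.2 ∈ Icc η (b - η)
    · have h1 : z.1 ∉ Icc (min ε (a / 3)) (max (a - ε) (2 * a / 3)) := fun h => hz ⟨h, h2⟩
      rw [mem_Icc, not_and_or, not_le, not_le] at h1
      rcases h1 with h1 | h1
      · have h3 := lt_min_iff.1 h1
        rw [smoothStep_of_le ha h3.2.le, zero_mul, sub_zero]
        simp only [hGdef]
        rw [intervalIntegral.integral_congr (g := fun _ => 0), intervalIntegral.integral_zero]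
        intro t ht
        refine hx (t, z.2) fun h => ?_
        have := (mem_uIcc.1 ht)
        have h4 : ε ≤ t := h.1
        rcases this with h | h <;> linarith [h.1, h.2]
      · have h3 := max_lt_iff.1 h1
        rw [smoothStep_of_ge ha h3.2.le, one_mul]
        simp only [hGdef]
        rw [intervalIntegral.integral_interval_sub_left ((hcont _).intervalIntegrable _ _)
          ((hcont _).intervalIntegrable _ _),
          intervalIntegral.integral_congr (g := fun _ => 0), intervalIntegral.integral_zero]
        intro t ht
        refine hx (t, z.2) fun h => ?_
        have := (mem_uIcc.1 ht)
        have h4 : t ≤ a - ε := h.2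
        rcases this with h | h <;> linarith [h.1, h.2]
    · rw [hG0 h2 a, show G z = G (z.1, z.2) from rfl, hG0 h2 z.1]; simp
  have hsub : tsupport (fun z : ℝ × ℝ => G z - smoothStep a z.1 * G (a, z.2)) ⊆
      Icc (min ε (a / 3)) (max (a - ε) (2 * a / 3)) ×ˢ Icc η (b - η) :=
    closure_minimal (fun z hz => by by_contra h; exact hz (hzero z h))
      (isClosed_Icc.prod isClosed_Icc)
  refine ⟨_, hΦ, HasCompactSupport.intro (isCompact_Icc.prod isCompact_Icc) hzero,
    hsub.trans ?_, fun z => ?_⟩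
  · refine prod_mono (fun x hx => ?_) fun y hy => ⟨by linarith [hy.1], by linarith [hy.2]⟩
    exact ⟨(lt_min hε (by positivity)).trans_le hx.1,
      hx.2.trans_lt (max_lt (by linarith) (by linarith))⟩
  · have hd := (hΦ.differentiable (by simp) z).hasFDerivAt.comp_hasDerivAt_of_eq z.1
      ((hasDerivAt_id z.1).prodMk (hasDerivAt_const z.1 z.2)) rfl
    have hd1 : HasDerivAt (fun x => G (x, z.2)) (φ (z.1, z.2)) z.1 :=
      ((hcont z.2).integral_hasStrictDerivAt 0 z.1).hasDerivAt
    have hd2 : HasDerivAt (smoothStep a) (deriv (smoothStep a) z.1) z.1 :=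
      ((contDiff_smoothStep a).differentiable (by simp) z.1).hasDerivAt
    have := hd.unique (hd1.sub (hd2.mul_const (G (a, z.2))))
    rw [this, ← integral_Ioc_eq_integral_Ioo, ← intervalIntegral.integral_of_le ha.le]

/-! ### Absolute continuity of Sobolev functions on lines -/

/-- `g` is a weak derivative of `f` on `U` in the direction `w`; this is `IsWeakDeriv` for functions
instead of classes of functions. -/
def HasWeakPartial (U : Set (ℝ × ℝ)) (w : ℝ × ℝ) (f g : ℝ × ℝ → ℂ) : Prop :=
  ∀ φ : ℝ × ℝ → ℝ, ContDiff ℝ ∞ φ → HasCompactSupport φ → tsupport φ ⊆ U →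
    ∫ z in U, (fderiv ℝ φ z w : ℂ) * f z = -∫ z in U, (φ z : ℂ) * g z

/-- The primitive `∫₀ˣ g(s) ds` for `x ∈ [0, a]`, written as an integral over the fixed
interval `(0, a)`. -/
noncomputable def cutPrimitive (a : ℝ) (g : ℝ → ℂ) (x : ℝ) : ℂ :=
  ∫ s in Ioo 0 a, if s ≤ x then g s else 0

lemma cutPrimitive_eq {a : ℝ} (g : ℝ → ℂ) {x : ℝ} (hx : x ∈ Icc 0 a) :
    cutPrimitive a g x = ∫ s in (0 : ℝ)..x, g s := by
  have : (fun s => if s ≤ x then g s else 0) = indicator (Iic x) g := by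
    ext s; simp [indicator]
  rw [cutPrimitive, this, setIntegral_indicator measurableSet_Iic,
    intervalIntegral.integral_of_le hx.1,
    setIntegral_congr_set (Ioo_ae_eq_Ioc.inter (ae_eq_refl (Iic x))), Ioc_inter_Iic,
    min_eq_right hx.2]

lemma norm_cutPrimitive_le {a : ℝ} (g : ℝ → ℂ) (hg : IntegrableOn g (Ioo 0 a)) (x : ℝ) :
    ‖cutPrimitive a g x‖ ≤ ∫ s in Ioo 0 a, ‖g s‖ := by
  refine norm_integral_le_of_norm_le hg.norm (ae_of_all _ fun s => ?_)
  split_ifs <;> simp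

/-- Integration by parts against the primitive of an integrable function. -/
lemma integral_deriv_mul_cutPrimitive {a : ℝ} {Φ Φ' : ℝ → ℝ}
    (hΦ : ∀ x, HasDerivAt Φ (Φ' x) x) (hΦ' : Continuous Φ') (hΦa : Φ a = 0) {g : ℝ → ℂ}
    (hg : IntegrableOn g (Ioo 0 a)) :
    ∫ x in Ioo 0 a, (Φ' x : ℂ) * cutPrimitive a g x = -∫ x in Ioo 0 a, (Φ x : ℂ) * g x := by
  have hΦi : IntegrableOn (fun x => (Φ' x : ℂ)) (Ioo 0 a) :=
    ((Complex.continuous_ofReal.comp hΦ').integrableOn_Icc (a := 0) (b := a)).mono_set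
      Ioo_subset_Icc_self
  have hint : Integrable (Function.uncurry fun x s => (Φ' x : ℂ) * if s ≤ x then g s else 0)
      ((volume.restrict (Ioo 0 a)).prod (volume.restrict (Ioo 0 a))) := by
    have := (Integrable.mul_prod hΦi hg).indicator
      (measurableSet_le (measurable_snd (α := ℝ) (β := ℝ)) measurable_fst)
    refine this.congr (ae_of_all _ fun z => ?_)
    simp only [indicator, Function.uncurry, mem_ofPred_eq]
    split_ifs <;> simp
  have h1 := integral_integral_swap hint
  have h2 : ∀ x, (Φ' x : ℂ) * cutPrimitive a g x =
      ∫ s in Ioo 0 a, (Φ' x : ℂ) * if s ≤ x then g s else 0 := fun x => by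
    rw [cutPrimitive, integral_const_mul]
  simp_rw [h2]
  rw [h1, ← integral_neg]
  refine setIntegral_congr_fun measurableSet_Ioo fun s hs => ?_
  have h3 : (fun x => (Φ' x : ℂ) * if s ≤ x then g s else 0) =
      indicator (Ici s) fun x => (Φ' x : ℂ) * g s := by
    ext x; simp [indicator]
  have h4 : Ioo 0 a ∩ Ici s = Ico s a := by
    ext x; simp only [mem_inter_iff, mem_Ioo, mem_Ici, mem_Ico]
    exact ⟨fun h => ⟨h.2, h.1.2⟩, fun h => ⟨⟨hs.1.trans_le h.1, h.2⟩, h.1⟩⟩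
  rw [h3, setIntegral_indicator measurableSet_Ici, h4, integral_mul_const,
    integral_Ico_eq_integral_Ioo, ← integral_Ioc_eq_integral_Ioo,
    ← intervalIntegral.integral_of_le hs.2.le, intervalIntegral.integral_ofReal,
    intervalIntegral.integral_eq_sub_of_hasDerivAt (fun x _ => hΦ x)
      (hΦ'.intervalIntegrable _ _), hΦa]
  push_cast; ring

/-- A function with a weak `x`-derivative on a rectangle is, on almost every horizontal line, the
sum of a constant and the primitive of its weak derivative. -/
theorem HasWeakPartial.exists_ae_eq_primitive {a b : ℝ} (ha : 0 < a) {f g : ℝ × ℝ → ℂ}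
    (hfm : StronglyMeasurable f) (hgm : StronglyMeasurable g)
    (hf : IntegrableOn f (rect a b)) (hg : IntegrableOn g (rect a b))
    (h : HasWeakPartial (rect a b) (1, 0) f g) :
    ∃ c : ℝ → ℂ, Measurable c ∧ ∀ᵐ y ∂volume.restrict (Ioo 0 b),
      IntegrableOn (fun x => g (x, y)) (Ioo 0 a) ∧
      ∀ᵐ x ∂volume.restrict (Ioo 0 a), f (x, y) = c y + cutPrimitive a (fun s => g (s, y)) x := by
  set μ : Measure ℝ := volume.restrict (Ioo 0 a) with hμ
  set ν : Measure ℝ := volume.restrict (Ioo 0 b) with hν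
  have hprod : volume.restrict (rect a b) = μ.prod ν := by
    rw [rect, Measure.volume_eq_prod, Measure.prod_restrict]
  rw [IntegrableOn, hprod] at hf hg
  set G : ℝ × ℝ → ℂ := fun z => cutPrimitive a (fun s => g (s, z.2)) z.1 with hG
  have hGm : StronglyMeasurable G := by
    refine StronglyMeasurable.integral_prod_right
      (f := fun (z : ℝ × ℝ) s => if s ≤ z.1 then g (s, z.2) else 0) ?_
    exact StronglyMeasurable.ite (measurableSet_le measurable_snd measurable_fst.fst)
      (hgm.comp_measurable (by fun_prop)) stronglyMeasurable_const
  have hGi : Integrable G (μ.prod ν) := by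
    refine (hg.integral_norm_prod_right.comp_snd μ).mono' hGm.aestronglyMeasurable ?_
    have h1 : ∀ᵐ y ∂ν, Integrable (fun x => g (x, y)) μ := hg.prod_left_ae
    filter_upwards [Measure.quasiMeasurePreserving_snd.ae h1] with z hz
    exact norm_cutPrimitive_le _ hz _
  have hW : Integrable (fun z => f z - G z) (μ.prod ν) := hf.sub hGi
  -- the mean of `f - G` in the `x`-direction with the weight `deriv (smoothStep a)`
  have hkc : Continuous (deriv (smoothStep a)) :=
    (contDiff_smoothStep a).continuous_deriv (by simp)
  obtain ⟨C, hC⟩ : ∃ C, ∀ x ∈ Icc 0 a, ‖deriv (smoothStep a) x‖ ≤ C :=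
    isCompact_Icc.exists_bound_of_continuousOn hkc.continuousOn
  have hkm : Continuous fun z : ℝ × ℝ => ((deriv (smoothStep a) z.1 : ℝ) : ℂ) :=
    Complex.continuous_ofReal.comp (hkc.comp continuous_fst)
  have hkW : Integrable (fun z => ((deriv (smoothStep a) z.1 : ℝ) : ℂ) * (f z - G z))
      (μ.prod ν) := by
    refine hW.bdd_mul (c := C) hkm.aestronglyMeasurable ?_
    have : ∀ᵐ x ∂μ, ‖deriv (smoothStep a) x‖ ≤ C := by
      filter_upwards [ae_restrict_mem measurableSet_Ioo] with x hx
      exact hC x (Ioo_subset_Icc_self hx)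
    filter_upwards [Measure.quasiMeasurePreserving_fst.ae this] with z hz
    simpa using hz
  set c : ℝ → ℂ := fun y => ∫ x, ((deriv (smoothStep a) x : ℝ) : ℂ) * (f (x, y) - G (x, y)) ∂μ
    with hc
  have hcm : StronglyMeasurable c := by
    refine StronglyMeasurable.integral_prod_right
      (f := fun y x => ((deriv (smoothStep a) x : ℝ) : ℂ) * (f (x, y) - G (x, y))) ?_
    exact (Complex.continuous_ofReal.comp (hkc.comp continuous_snd)).stronglyMeasurable.mul
      ((hfm.comp_measurable measurable_swap).sub (hGm.comp_measurable measurable_swap))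
  have hci : Integrable c ν := hkW.integral_prod_right
  have hcp : Integrable (fun z : ℝ × ℝ => c z.2) (μ.prod ν) := hci.comp_snd μ
  have bddmul : ∀ {φ : ℝ × ℝ → ℝ} {u : ℝ × ℝ → ℂ}, Continuous φ → HasCompactSupport φ →
      Integrable u (μ.prod ν) → Integrable (fun z => (φ z : ℂ) * u z) (μ.prod ν) := by
    intro φ u hφ hφc hu
    obtain ⟨C, hC⟩ := hφc.exists_bound_of_continuous hφ
    exact hu.bdd_mul (Complex.continuous_ofReal.comp hφ).aestronglyMeasurable
      (ae_of_all _ fun z => by simpa using hC z)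
  have main : ∀ᵐ z ∂(μ.prod ν), z ∈ rect a b → f z - G z - c z.2 = 0 := by
    refine IsOpen.ae_eq_zero_of_integral_contDiff_smul_eq_zero (f := fun z => f z - G z - c z.2)
      (isOpen_Ioo.prod isOpen_Ioo)
      ((hW.sub hcp).locallyIntegrable.locallyIntegrableOn _) fun φ hφ hφc hφs => ?_
    obtain ⟨Φ, hΦ, hΦc, hΦs, hΦd⟩ := exists_testFunction_fderiv_eq ha hφ hφc hφs
    have hweak := h Φ hΦ hΦc hΦs
    rw [hprod] at hweak
    have hd : Continuous fun z => fderiv ℝ Φ z (1, 0) :=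
      (hΦ.continuous_fderiv (by simp)).clm_apply continuous_const
    have hdc : HasCompactSupport fun z => fderiv ℝ Φ z (1, 0) :=
      hΦc.fderiv_apply (𝕜 := ℝ) (1, 0)
    -- integrate by parts along the horizontal lines
    have hparts : ∫ z, ((fderiv ℝ Φ z (1, 0) : ℝ) : ℂ) * G z ∂(μ.prod ν) =
        -∫ z, (Φ z : ℂ) * g z ∂(μ.prod ν) := by
      rw [integral_prod_symm _ (bddmul hd hdc hGi),
        integral_prod_symm _ (bddmul hΦ.continuous hΦc hg), ← integral_neg]
      refine integral_congr_ae ?_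
      filter_upwards [hg.prod_left_ae] with y hy
      refine integral_deriv_mul_cutPrimitive (Φ := fun x => Φ (x, y))
        (Φ' := fun x => fderiv ℝ Φ (x, y) (1, 0)) (fun x => ?_) (hd.comp (by fun_prop)) ?_ hy
      · exact (hΦ.differentiable (by simp) (x, y)).hasFDerivAt.comp_hasDerivAt x
          ((hasDerivAt_id x).prodMk (hasDerivAt_const x y))
      · exact image_eq_zero_of_notMem_tsupport fun hm => lt_irrefl a (hΦs hm).1.2
    have hzero : ∫ z, ((fderiv ℝ Φ z (1, 0) : ℝ) : ℂ) * (f z - G z) ∂(μ.prod ν) = 0 := by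
      simp_rw [mul_sub]
      rw [integral_sub (bddmul hd hdc hf) (bddmul hd hdc hGi), hweak, hparts, sub_self]
    -- the weighted mean absorbs the part of `φ` that is not an `x`-derivative
    have hcross : ∫ z, (φ z : ℂ) * (f z - G z) ∂(μ.prod ν) -
        ∫ z, ((fderiv ℝ Φ z (1, 0) : ℝ) : ℂ) * (f z - G z) ∂(μ.prod ν) =
        ∫ z, (φ z : ℂ) * c z.2 ∂(μ.prod ν) := by
      rw [← integral_sub (bddmul hφ.continuous hφc hW) (bddmul hd hdc hW),
        integral_prod_symm _ (bddmul hφ.continuous hφc hcp),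
        integral_prod_symm (fun z => (φ z : ℂ) * (f z - G z) -
          ((fderiv ℝ Φ z (1, 0) : ℝ) : ℂ) * (f z - G z))
          ((bddmul hφ.continuous hφc hW).sub (bddmul hd hdc hW))]
      refine integral_congr_ae (ae_of_all _ fun y => ?_)
      simp only [integral_mul_const, hΦd]
      rw [show ∫ x, (φ (x, y) : ℂ) ∂μ = ((∫ x, φ (x, y) ∂μ : ℝ) : ℂ) from integral_ofReal, hc,
        ← integral_const_mul]
      refine integral_congr_ae (ae_of_all _ fun x => ?_)
      simp only
      push_cast
      ring
    have : ∀ z, φ z • (f z - G z - c z.2) = (φ z : ℂ) * (f z - G z) - (φ z : ℂ) * c z.2 :=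
      fun z => by rw [Complex.real_smul, mul_sub]
    change ∫ z, φ z • (f z - G z - c z.2) ∂(μ.prod ν) = 0
    simp_rw [this]
    rw [integral_sub (bddmul hφ.continuous hφc hW) (bddmul hφ.continuous hφc hcp), ← hcross,
      hzero, sub_zero, sub_self]
  have main' : ∀ᵐ z ∂(ν.prod μ), z.swap ∈ rect a b → f z.swap - G z.swap - c z.swap.2 = 0 :=
    Measure.measurePreserving_swap.quasiMeasurePreserving.ae main
  refine ⟨c, hcm.measurable, ?_⟩
  filter_upwards [Measure.ae_ae_of_ae_prod main', hg.prod_left_ae,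
    ae_restrict_mem measurableSet_Ioo] with y hy hgy hyb
  refine ⟨hgy, ?_⟩
  filter_upwards [hy, ae_restrict_mem measurableSet_Ioo] with x hx hxa
  have := hx ⟨hxa, hyb⟩
  simp only [Prod.swap_prod_mk, sub_eq_iff_eq_add, zero_add] at this
  exact this

/-! ### Traces on the vertical sides of a rectangle -/

lemma ENNReal.add_sq_le_two_mul (x y : ENNReal) : (x + y) ^ 2 ≤ 2 * x ^ 2 + 2 * y ^ 2 := by
  induction x using ENNReal.recTopCoe with
  | top => simp
  | coe x =>
    induction y using ENNReal.recTopCoe with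
    | top => simp
    | coe y => exact_mod_cast (add_sq_le (a := x) (b := y)).trans (by rw [mul_add])

/-- Cauchy-Schwarz against the constant function `1`. -/
lemma sq_lintegral_le_measure_univ_mul {α : Type*} [MeasurableSpace α] (μ : Measure α)
    {u : α → ENNReal} (hu : AEMeasurable u μ) :
    (∫⁻ x, u x ∂μ) ^ 2 ≤ μ univ * ∫⁻ x, u x ^ 2 ∂μ := by
  have h := ENNReal.lintegral_mul_le_Lp_mul_Lq μ Real.HolderConjugate.two_two
    (f := fun _ => 1) aemeasurable_const hu
  have h2 := pow_le_pow_left₀ (zero_le) h 2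
  rw [mul_pow, ← ENNReal.rpow_natCast, ← ENNReal.rpow_natCast, ← ENNReal.rpow_natCast,
    ← ENNReal.rpow_mul, ← ENNReal.rpow_mul] at h2
  simpa using h2

lemma enorm_cutPrimitive_sub_le {a q r : ℝ} {g : ℝ → ℂ} (hg : IntegrableOn g (Ioo 0 a)) {x p : ℝ}
    (hq : 0 ≤ q) (hr : r ≤ a) (hx : x ∈ Icc q r) (hp : p ∈ Icc q r) :
    ‖cutPrimitive a g p - cutPrimitive a g x‖ₑ ≤ ∫⁻ s in Ioc q r, ‖g s‖ₑ := by
  have hg' : IntegrableOn g (Icc 0 a) := by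
    rwa [integrableOn_Icc_iff_integrableOn_Ioo]
  have hint : ∀ y ∈ Icc q r, IntervalIntegrable g volume 0 y := fun y hy =>
    (intervalIntegrable_iff_integrableOn_Icc_of_le (hq.trans hy.1)).2
      (hg'.mono_set (Icc_subset_Icc le_rfl (hy.2.trans hr)))
  rw [cutPrimitive_eq g ⟨hq.trans hp.1, hp.2.trans hr⟩,
    cutPrimitive_eq g ⟨hq.trans hx.1, hx.2.trans hr⟩,
    intervalIntegral.integral_interval_sub_left (hint p hp) (hint x hx),
    ← ofReal_norm, intervalIntegral.norm_intervalIntegral_eq, ofReal_norm]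
  refine (enorm_integral_le_lintegral_enorm _).trans (lintegral_mono_set ?_)
  rw [uIoc]
  exact Ioc_subset_Ioc (le_min hx.1 hp.1) (max_le hx.2 hp.2)

/-- The one-dimensional trace inequality: average
`‖h p‖ ≤ ‖h x‖ + ∫ ‖h'‖` over `x` in an interval of length `δ` that contains `p`. -/
lemma ofReal_mul_enorm_sq_le {a p δ : ℝ} (hp : p ∈ Icc 0 a) (hδ : δ ∈ Ioc 0 a) {c : ℂ}
    {f g : ℝ → ℂ} (hg : IntegrableOn g (Ioo 0 a))
    (hf : ∀ᵐ x ∂volume.restrict (Ioo 0 a), f x = c + cutPrimitive a g x) :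
    ENNReal.ofReal δ * ‖c + cutPrimitive a g p‖ₑ ^ 2 ≤
      2 * (∫⁻ x in Ioo 0 a, ‖f x‖ₑ ^ 2) +
        2 * ENNReal.ofReal δ ^ 2 * ∫⁻ x in Ioo 0 a, ‖g x‖ₑ ^ 2 := by
  -- an interval `[q, q + δ] ⊆ [0, a]` around `p`, averaged over below
  obtain ⟨q, hq0, hqa, hqp⟩ : ∃ q, 0 ≤ q ∧ q + δ ≤ a ∧ p ∈ Icc q (q + δ) := by
    refine ⟨min p (a - δ), le_min hp.1 (by linarith [hδ.2]),
      by linarith [min_le_right p (a - δ)], min_le_left _ _, ?_⟩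
    rcases min_choice p (a - δ) with h | h <;> rw [h] <;> linarith [hp.2, hδ.1]
  set J := Ioc q (q + δ) with hJ
  have hJa : J ⊆ Ioc 0 a := Ioc_subset_Ioc hq0 hqa
  have hgc : IntegrableOn g (Ioc 0 a) := by rwa [← integrableOn_Ioc_iff_integrableOn_Ioo] at hg
  rw [restrict_Ioo_eq_restrict_Ioc] at hf ⊢
  have hvol : volume J = ENNReal.ofReal δ := by rw [hJ, Real.volume_Ioc, add_sub_cancel_left]
  have hgJ : AEMeasurable (fun s => ‖g s‖ₑ) (volume.restrict J) :=
    (hgc.mono_set hJa).aestronglyMeasurable.enorm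
  have hCS : (∫⁻ s in J, ‖g s‖ₑ) ^ 2 ≤ ENNReal.ofReal δ * ∫⁻ s in Ioc 0 a, ‖g s‖ₑ ^ 2 := by
    refine (sq_lintegral_le_measure_univ_mul _ hgJ).trans ?_
    rw [Measure.restrict_apply_univ, hvol]
    gcongr
  have hpt : ∀ᵐ x ∂volume.restrict J, ‖c + cutPrimitive a g p‖ₑ ^ 2 ≤
      2 * ‖f x‖ₑ ^ 2 + 2 * (ENNReal.ofReal δ * ∫⁻ s in Ioc 0 a, ‖g s‖ₑ ^ 2) := by
    filter_upwards [ae_restrict_of_ae_restrict_of_subset hJa hf,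
      ae_restrict_mem measurableSet_Ioc] with x hx hxJ
    have h1 : ‖c + cutPrimitive a g p‖ₑ ≤ ‖f x‖ₑ + ∫⁻ s in J, ‖g s‖ₑ := by
      rw [show c + cutPrimitive a g p = f x + (cutPrimitive a g p - cutPrimitive a g x) by
        rw [hx]; ring]
      refine (enorm_add_le _ _).trans ?_
      gcongr
      exact enorm_cutPrimitive_sub_le hg hq0 hqa (Ioc_subset_Icc_self hxJ) hqp
    calc _ ≤ (‖f x‖ₑ + ∫⁻ s in J, ‖g s‖ₑ) ^ 2 := by gcongr
      _ ≤ _ := ENNReal.add_sq_le_two_mul _ _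
      _ ≤ _ := by gcongr
  have hfm : AEMeasurable (fun x => 2 * ‖f x‖ₑ ^ 2) (volume.restrict J) := by
    have h1 : AEStronglyMeasurable (fun x => c + cutPrimitive a g x) (volume.restrict J) := by
      refine AEStronglyMeasurable.add aestronglyMeasurable_const ?_
      have hcont : ContinuousOn (fun x => ∫ s in (0 : ℝ)..x, g s) (uIcc 0 a) :=
        intervalIntegral.continuousOn_primitive_interval (by
          rwa [uIcc_of_le (hδ.1.le.trans hδ.2), integrableOn_Icc_iff_integrableOn_Ioo])
      rw [uIcc_of_le (hδ.1.le.trans hδ.2)] at hcont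
      refine ((hcont.mono (hJa.trans Ioc_subset_Icc_self)).aestronglyMeasurable
        measurableSet_Ioc).congr ?_
      filter_upwards [ae_restrict_mem measurableSet_Ioc] with x hx
      exact (cutPrimitive_eq g (Ioc_subset_Icc_self (hJa hx))).symm
    have h2 : AEStronglyMeasurable f (volume.restrict J) :=
      h1.congr ((ae_restrict_of_ae_restrict_of_subset hJa hf).mono fun x hx => hx.symm)
    exact (h2.enorm.pow_const 2).const_mul 2
  calc ENNReal.ofReal δ * ‖c + cutPrimitive a g p‖ₑ ^ 2
      = ∫⁻ _ in J, ‖c + cutPrimitive a g p‖ₑ ^ 2 := by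
        rw [setLIntegral_const, hvol, mul_comm]
    _ ≤ ∫⁻ x in J, (2 * ‖f x‖ₑ ^ 2 +
          2 * (ENNReal.ofReal δ * ∫⁻ s in Ioc 0 a, ‖g s‖ₑ ^ 2)) := lintegral_mono_ae hpt
    _ = 2 * (∫⁻ x in J, ‖f x‖ₑ ^ 2) +
          2 * ENNReal.ofReal δ ^ 2 * ∫⁻ s in Ioc 0 a, ‖g s‖ₑ ^ 2 := by
        rw [lintegral_add_left' hfm, lintegral_const_mul' _ _ (by simp), setLIntegral_const, hvol]
        ring
    _ ≤ _ := by gcongr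

/-- The trace theorem for a vertical line `x = p` of the rectangle (in applications a side),
with the trace inequality for a free parameter `δ`. -/
theorem HasWeakPartial.exists_trace {a b p : ℝ} (ha : 0 < a) (hp : p ∈ Icc 0 a)
    {f g : ℝ × ℝ → ℂ} (hfm : StronglyMeasurable f) (hgm : StronglyMeasurable g)
    (hf : IntegrableOn f (rect a b)) (hg : IntegrableOn g (rect a b))
    (h : HasWeakPartial (rect a b) (1, 0) f g) :
    ∃ T : ℝ → ℂ, Measurable T ∧
      (∀ᵐ y ∂volume.restrict (Ioo 0 b),
        Tendsto (fun x => f (x, y)) (ae volume ⊓ 𝓝[Ioo 0 a] p) (𝓝 (T y))) ∧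
      ∀ δ ∈ Ioc 0 a, ENNReal.ofReal δ * ∫⁻ y in Ioo 0 b, ‖T y‖ₑ ^ 2 ≤
        2 * (∫⁻ z in rect a b, ‖f z‖ₑ ^ 2) +
          2 * ENNReal.ofReal δ ^ 2 * ∫⁻ z in rect a b, ‖g z‖ₑ ^ 2 := by
  obtain ⟨c, hcm, hc⟩ := h.exists_ae_eq_primitive ha hfm hgm hf hg
  have hprod : volume.restrict (rect a b) =
      (volume.restrict (Ioo 0 a)).prod (volume.restrict (Ioo 0 b)) := by
    rw [rect, Measure.volume_eq_prod, Measure.prod_restrict]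
  refine ⟨fun y => c y + cutPrimitive a (fun s => g (s, y)) p, ?_, ?_, fun δ hδ => ?_⟩
  · refine hcm.add (StronglyMeasurable.integral_prod_right
      (f := fun (y : ℝ) s => if s ≤ p then g (s, y) else 0) ?_).measurable
    exact StronglyMeasurable.ite (measurableSet_le measurable_snd measurable_const)
      (hgm.comp_measurable measurable_swap) stronglyMeasurable_const
  · filter_upwards [hc] with y hy
    obtain ⟨hgy, hfy⟩ := hy
    have hcont : ContinuousOn (fun x => ∫ s in (0 : ℝ)..x, g (s, y)) (uIcc 0 a) :=
      intervalIntegral.continuousOn_primitive_interval (by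
        rwa [uIcc_of_le ha.le, integrableOn_Icc_iff_integrableOn_Ioo])
    rw [uIcc_of_le ha.le] at hcont
    have hlim : Tendsto (fun x => c y + ∫ s in (0 : ℝ)..x, g (s, y)) (𝓝[Ioo 0 a] p)
        (𝓝 (c y + cutPrimitive a (fun s => g (s, y)) p)) := by
      rw [cutPrimitive_eq _ hp]
      exact ((hcont p hp).mono_left (nhdsWithin_mono _ Ioo_subset_Icc_self)).const_add _
    refine (hlim.mono_left inf_le_right).congr' ?_
    rw [ae_restrict_iff' measurableSet_Ioo] at hfy
    filter_upwards [hfy.filter_mono inf_le_left,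
      (eventually_mem_nhdsWithin : ∀ᶠ x in 𝓝[Ioo 0 a] p, x ∈ Ioo 0 a).filter_mono inf_le_right]
      with x hx hxa
    rw [hx hxa, cutPrimitive_eq _ (Ioo_subset_Icc_self hxa)]
  · rw [hprod, lintegral_prod_symm _ (hfm.enorm.pow_const 2).aemeasurable,
      lintegral_prod_symm _ (hgm.enorm.pow_const 2).aemeasurable,
      ← lintegral_const_mul' _ _ ENNReal.ofReal_ne_top, ← lintegral_const_mul' _ _ (by simp),
      ← lintegral_const_mul' _ _ (ENNReal.mul_ne_top (by simp) (by simp)),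
      ← lintegral_add_left]
    · refine lintegral_mono_ae ?_
      filter_upwards [hc] with y hy
      exact ofReal_mul_enorm_sq_le hp hδ hy.1 hy.2
    · exact ((hfm.enorm.pow_const 2).lintegral_prod_left').const_mul 2

/-! ### Weak derivatives in `L²` -/

/-- Integration against a test function is a bounded functional on `L²(U)`. -/
lemma exists_integral_mul_eq_inner (U : Set (ℝ × ℝ)) {φ : ℝ × ℝ → ℝ} (hφ : Continuous φ)
    (hc : HasCompactSupport φ) :
    ∃ F : L2 U, ∀ u : L2 U, ∫ z in U, (φ z : ℂ) * u z = inner ℂ F u := by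
  have hm : MemLp (fun z => (φ z : ℂ)) 2 (volume.restrict U) :=
    (Complex.continuous_ofReal.comp hφ).memLp_of_hasCompactSupport
      (hc.comp_left Complex.ofReal_zero)
  refine ⟨hm.toLp _, fun u => ?_⟩
  rw [L2.inner_def]
  refine integral_congr_ae ?_
  filter_upwards [hm.coeFn_toLp] with z hz
  rw [hz, RCLike.inner_apply, Complex.conj_ofReal, mul_comm]

/-- The weak derivative as a family of orthogonality relations in `L²(U)`. -/
lemma exists_isWeakDeriv_iff_inner (U : Set (ℝ × ℝ)) (w : ℝ × ℝ) :
    ∃ S : Set (L2 U × L2 U), ∀ u v : L2 U,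
      IsWeakDeriv U w u v ↔ ∀ F ∈ S, inner ℂ F.1 u = -inner ℂ F.2 v := by
  refine ⟨{F | ∃ φ : ℝ × ℝ → ℝ, ContDiff ℝ ∞ φ ∧ HasCompactSupport φ ∧ tsupport φ ⊆ U ∧
    (∀ u : L2 U, ∫ z in U, (fderiv ℝ φ z w : ℂ) * u z = inner ℂ F.1 u) ∧
    ∀ u : L2 U, ∫ z in U, (φ z : ℂ) * u z = inner ℂ F.2 u}, fun u v => ⟨?_, ?_⟩⟩
  · rintro h F ⟨φ, h1, h2, h3, h4, h5⟩
    rw [← h4, ← h5]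
    exact h φ h1 h2 h3
  · intro h φ h1 h2 h3
    obtain ⟨F, hF⟩ := exists_integral_mul_eq_inner U
      ((h1.continuous_fderiv (by simp)).clm_apply (continuous_const (y := w)))
      (h2.fderiv_apply (𝕜 := ℝ) w)
    obtain ⟨G, hG⟩ := exists_integral_mul_eq_inner U h1.continuous h2
    rw [hF, hG]
    exact h (F, G) ⟨φ, h1, h2, h3, hF, hG⟩

section WeakDeriv

variable {U : Set (ℝ × ℝ)} {w : ℝ × ℝ} {u u' v v' : L2 U}

lemma IsWeakDeriv.add (h : IsWeakDeriv U w u v) (h' : IsWeakDeriv U w u' v') :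
    IsWeakDeriv U w (u + u') (v + v') := by
  obtain ⟨S, hS⟩ := exists_isWeakDeriv_iff_inner U w
  rw [hS] at h h' ⊢
  intro F hF
  rw [inner_add_right, inner_add_right, h F hF, h' F hF]; ring

lemma IsWeakDeriv.smul (c : ℂ) (h : IsWeakDeriv U w u v) : IsWeakDeriv U w (c • u) (c • v) := by
  obtain ⟨S, hS⟩ := exists_isWeakDeriv_iff_inner U w
  rw [hS] at h ⊢
  intro F hF
  rw [inner_smul_right, inner_smul_right, h F hF]; ring

lemma isWeakDeriv_zero : IsWeakDeriv U w 0 0 := by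
  obtain ⟨S, hS⟩ := exists_isWeakDeriv_iff_inner U w
  rw [hS]
  intro F _
  simp

/-- Weak differentiation is a closed operator. -/
lemma IsWeakDeriv.of_tendsto {x y : ℕ → L2 U} (h : ∀ n, IsWeakDeriv U w (x n) (y n))
    (hx : Tendsto x atTop (𝓝 u)) (hy : Tendsto y atTop (𝓝 v)) : IsWeakDeriv U w u v := by
  obtain ⟨S, hS⟩ := exists_isWeakDeriv_iff_inner U w
  simp only [hS] at h ⊢
  intro F hF
  have h1 : Tendsto (fun n => inner ℂ F.1 (x n)) atTop (𝓝 (inner ℂ F.1 u)) :=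
    tendsto_const_nhds.inner hx
  have h2 : Tendsto (fun n => -inner ℂ F.2 (y n)) atTop (𝓝 (-inner ℂ F.2 v)) :=
    (tendsto_const_nhds.inner hy).neg
  exact tendsto_nhds_unique h1 (by simpa only [h _ F hF] using h2)

lemma IsWeakDeriv.unique (hU : IsOpen U) (h : IsWeakDeriv U w u v) (h' : IsWeakDeriv U w u v') :
    v = v' := by
  have hsub : IsWeakDeriv U w 0 (v - v') := by
    have := h.add (h'.smul (-1))
    simpa [sub_eq_add_neg] using this
  rw [← sub_eq_zero]
  have hloc : LocallyIntegrable (v - v' : L2 U) (volume.restrict U) :=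
    (Lp.memLp (v - v')).locallyIntegrable (by norm_num)
  have hae := hU.ae_eq_zero_of_integral_contDiff_smul_eq_zero
    (hloc.locallyIntegrableOn U) fun φ h1 h2 h3 => by
      have h4 := hsub φ h1 h2 h3
      have h5 : ∫ z in U, (fderiv ℝ φ z w : ℂ) * (0 : L2 U) z = 0 := by
        refine integral_eq_zero_of_ae ?_
        filter_upwards [Lp.coeFn_zero ℂ 2 (volume.restrict U)] with z hz
        rw [hz, Pi.zero_apply, mul_zero]
      rw [h5, eq_comm, neg_eq_zero] at h4
      simpa only [Complex.real_smul] using h4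
  rw [Lp.eq_zero_iff_ae_eq_zero]
  filter_upwards [hae, ae_restrict_mem hU.measurableSet] with z hz hzU
  exact hz hzU

lemma IsWeakDeriv.weakDeriv_eq (hU : IsOpen U) (h : IsWeakDeriv U w u v) :
    weakDeriv U w u = v := by
  have hex : ∃ v, IsWeakDeriv U w u v := ⟨v, h⟩
  rw [weakDeriv, dif_pos hex]
  exact hex.choose_spec.unique hU h

lemma isWeakDeriv_weakDeriv (h : ∃ v, IsWeakDeriv U w u v) :
    IsWeakDeriv U w u (weakDeriv U w u) := by
  rw [weakDeriv, dif_pos h]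
  exact h.choose_spec

end WeakDeriv

lemma L2.enorm_sq_eq_lintegral {U : Set (ℝ × ℝ)} (u : L2 U) :
    ‖u‖ₑ ^ 2 = ∫⁻ z in U, ‖u z‖ₑ ^ 2 := by
  have := eLpNorm_nnreal_pow_eq_lintegral (μ := volume.restrict U) (f := u) (p := 2) two_ne_zero
  rw [Lp.enorm_def]
  simp only [NNReal.coe_ofNat, ENNReal.coe_ofNat, ENNReal.rpow_ofNat] at this
  exact this

lemma isOpen_rect (a b : ℝ) : IsOpen (rect a b) := isOpen_Ioo.prod isOpen_Ioo

lemma integrableOn_rect {a b : ℝ} (u : L2 (rect a b)) : IntegrableOn u (rect a b) := by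
  have : IsFiniteMeasure (volume.restrict (rect a b)) := by
    refine ⟨?_⟩
    rw [Measure.restrict_apply_univ, rect, Measure.volume_eq_prod, Measure.prod_prod]
    simp [ENNReal.mul_lt_top]
  exact (Lp.memLp u).integrable (by norm_num)

lemma preimage_swap_rect (a b : ℝ) : Prod.swap ⁻¹' rect a b = rect b a := by
  ext z; simp only [rect, mem_preimage, mem_prod, Prod.fst_swap, Prod.snd_swap]; tauto

lemma measurePreserving_swap_plane :
    MeasurePreserving (Prod.swap : ℝ × ℝ → ℝ × ℝ) volume volume := by
  rw [Measure.volume_eq_prod]; exact Measure.measurePreserving_swap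

/-- Exchanging the coordinates turns a weak `y`-derivative into a weak `x`-derivative. -/
lemma HasWeakPartial.comp_swap {a b : ℝ} {f g : ℝ × ℝ → ℂ}
    (h : HasWeakPartial (rect a b) (0, 1) f g) :
    HasWeakPartial (rect b a) (1, 0) (f ∘ Prod.swap) (g ∘ Prod.swap) := by
  intro φ h1 h2 h3
  have hemb : MeasurableEmbedding (Prod.swap : ℝ × ℝ → ℝ × ℝ) :=
    MeasurableEquiv.prodComm.measurableEmbedding
  have hsupp : tsupport (φ ∘ Prod.swap) = Prod.swap ⁻¹' tsupport φ :=
    tsupport_comp_eq_preimage φ (Homeomorph.prodComm ℝ ℝ)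
  have key := h (φ ∘ Prod.swap) (h1.comp (contDiff_snd.prodMk contDiff_fst))
    (h2.comp_homeomorph (Homeomorph.prodComm ℝ ℝ)) (by
      rw [hsupp, ← preimage_swap_rect]; exact preimage_mono h3)
  have hder : ∀ z : ℝ × ℝ, fderiv ℝ (φ ∘ Prod.swap) z (0, 1) = fderiv ℝ φ z.swap (1, 0) := by
    intro z
    have := ((h1.differentiable (by simp) z.swap).hasFDerivAt).comp z
      (ContinuousLinearEquiv.prodComm ℝ ℝ ℝ).hasFDerivAt
    exact congrArg (fun A : ℝ × ℝ →L[ℝ] ℝ => A (0, 1)) this.fderiv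
  simp only [hder] at key
  have hint := fun k : ℝ × ℝ → ℂ =>
    measurePreserving_swap_plane.setIntegral_preimage_emb hemb k (rect a b)
  rw [← hint fun z => ((fderiv ℝ φ z.swap (1, 0) : ℝ) : ℂ) * f z,
    ← hint fun z => (((φ ∘ Prod.swap) z : ℝ) : ℂ) * g z, preimage_swap_rect] at key
  simpa using key

/-! ### Boundary values -/

lemma map_mul_left_unitMeasure {b : ℝ} (hb : 0 < b) :
    Measure.map (fun y => b * y) unitMeasure =
      ENNReal.ofReal b⁻¹ • volume.restrict (Ioo 0 b) := by
  have h1 : (fun y => b * y) ⁻¹' Icc 0 b = Icc 0 1 := by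
    ext y
    simp only [mem_preimage, mem_Icc]
    constructor <;> rintro ⟨h, h'⟩ <;> constructor <;> nlinarith
  have h2 := Measure.restrict_map (μ := (volume : Measure ℝ)) (measurable_const_mul b)
    (measurableSet_Icc (a := 0) (b := b))
  rw [h1] at h2
  rw [← h2, Real.map_volume_mul_left hb.ne', abs_of_pos (inv_pos.2 hb), Measure.restrict_smul,
    restrict_Ioo_eq_restrict_Icc]

lemma ae_unitMeasure_of_ae_Ioo {b : ℝ} (hb : 0 < b) {p : ℝ → Prop}
    (h : ∀ᵐ s ∂volume.restrict (Ioo 0 b), p s) : ∀ᵐ y ∂unitMeasure, p (b * y) := by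
  refine ae_of_ae_map (measurable_const_mul b).aemeasurable ?_
  rw [map_mul_left_unitMeasure hb]
  exact Measure.ae_smul_measure h _

/-- The trace theorem with the side parametrized by the unit interval; the factor `√b` makes the
parametrization isometric in `L²`. -/
lemma HasWeakPartial.exists_unit_trace {a b p : ℝ} (ha : 0 < a) (hb : 0 < b) (hp : p ∈ Icc 0 a)
    {f g : ℝ × ℝ → ℂ} (hfm : StronglyMeasurable f) (hgm : StronglyMeasurable g)
    (hf : IntegrableOn f (rect a b)) (hg : IntegrableOn g (rect a b))
    (h : HasWeakPartial (rect a b) (1, 0) f g) :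
    ∃ T : ℝ → ℂ, Measurable T ∧
      (∀ᵐ y ∂unitMeasure,
        Tendsto (fun x => f (x, b * y)) (ae volume ⊓ 𝓝[Ioo 0 a] p) (𝓝 (T y))) ∧
      ∀ δ ∈ Ioc 0 a, ENNReal.ofReal δ * ∫⁻ y, ‖(Real.sqrt b : ℂ) * T y‖ₑ ^ 2 ∂unitMeasure ≤
        2 * (∫⁻ z in rect a b, ‖f z‖ₑ ^ 2) +
          2 * ENNReal.ofReal δ ^ 2 * ∫⁻ z in rect a b, ‖g z‖ₑ ^ 2 := by
  obtain ⟨T, hTm, hT, hle⟩ := h.exists_trace ha hp hfm hgm hf hg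
  refine ⟨fun y => T (b * y), hTm.comp (measurable_const_mul b), ae_unitMeasure_of_ae_Ioo hb hT,
    fun δ hδ => ?_⟩
  convert hle δ hδ using 2
  have h1 : ‖(Real.sqrt b : ℂ)‖ₑ ^ 2 = ENNReal.ofReal b := by
    rw [← ofReal_norm, Complex.norm_real, Real.norm_of_nonneg (Real.sqrt_nonneg _),
      ← ENNReal.ofReal_pow (Real.sqrt_nonneg _), Real.sq_sqrt hb.le]
  have h2 : ∫⁻ y, ‖T (b * y)‖ₑ ^ 2 ∂unitMeasure =
      ENNReal.ofReal b⁻¹ * ∫⁻ y in Ioo 0 b, ‖T y‖ₑ ^ 2 := by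
    rw [← lintegral_map (f := fun s => ‖T s‖ₑ ^ 2) (hTm.enorm.pow_const 2)
      (measurable_const_mul b), map_mul_left_unitMeasure hb, lintegral_smul_measure, smul_eq_mul]
  simp_rw [enorm_mul, mul_pow, h1]
  rw [lintegral_const_mul' _ _ ENNReal.ofReal_ne_top, h2, ← mul_assoc, ← ENNReal.ofReal_mul hb.le,
    mul_inv_cancel₀ hb.ne', ENNReal.ofReal_one, one_mul]

lemma ae_ae_rect {a b : ℝ} {p : ℝ × ℝ → Prop} (h : ∀ᵐ z ∂volume.restrict (rect a b), p z) :
    ∀ᵐ x ∂volume.restrict (Ioo 0 a), ∀ᵐ y ∂volume.restrict (Ioo 0 b), p (x, y) := by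
  rw [rect, Measure.volume_eq_prod, ← Measure.prod_restrict] at h
  exact Measure.ae_ae_of_ae_prod h

lemma ae_rect_swap {a b : ℝ} {p : ℝ × ℝ → Prop} (h : ∀ᵐ z ∂volume.restrict (rect a b), p z) :
    ∀ᵐ z ∂volume.restrict (rect b a), p z.swap := by
  rw [rect, Measure.volume_eq_prod, ← Measure.prod_restrict] at h ⊢
  exact Measure.measurePreserving_swap.quasiMeasurePreserving.ae h

lemma neBot_ae_inf_nhdsWithin_Ioo {a p : ℝ} (ha : 0 < a) (hp : p ∈ Icc 0 a) :
    (ae volume ⊓ 𝓝[Ioo 0 a] p).NeBot := by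
  rw [Filter.inf_neBot_iff]
  intro s hs t ht
  obtain ⟨u, hu, hpu, hut⟩ := mem_nhdsWithin.1 ht
  have hne : (u ∩ Ioo 0 a).Nonempty := by
    rw [← closure_Ioo ha.ne] at hp
    exact mem_closure_iff.1 hp u hu hpu
  have hpos : 0 < volume (u ∩ Ioo 0 a) := (hu.inter isOpen_Ioo).measure_pos volume hne
  by_contra hempty
  have hsub : u ∩ Ioo 0 a ⊆ sᶜ := fun x hx hxs => hempty ⟨x, hxs, hut hx⟩
  exact hpos.ne' (measure_mono_null hsub (mem_ae_iff.1 hs))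

section Sides

variable {V E : Type*}

/-- The direction transversal to a side. -/
def Side.normal : Side → ℝ × ℝ
  | left | right => (1, 0)
  | bottom | top => (0, 1)

/-- The extent of the rectangle transversal to the side. -/
def sideDepth (Γ : CompactMetricGraph V E) : BVIndex E → ℝ
  | (e, .left) | (e, .right) => Γ.length e.1
  | (e, .bottom) | (e, .top) => Γ.length e.2

/-- The point with transversal coordinate `t` in the slice through the point with parameter `y`
of a side. -/
def sidePoint (Γ : CompactMetricGraph V E) (i : BVIndex E) (y t : ℝ) : ℝ × ℝ :=
  match i with
  | (e, .left) | (e, .right) => (t, Γ.length e.2 * y)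
  | (e, .bottom) | (e, .top) => (Γ.length e.1 * y, t)

lemma sideDepth_pos (Γ : CompactMetricGraph V E) (i : BVIndex E) : 0 < sideDepth Γ i := by
  obtain ⟨e, s⟩ := i
  cases s <;> exact Γ.length_pos _

lemma exists_sideFilter_eq (Γ : CompactMetricGraph V E) (i : BVIndex E) :
    ∃ p ∈ Icc 0 (sideDepth Γ i), sideFilter Γ i = ae volume ⊓ 𝓝[Ioo 0 (sideDepth Γ i)] p := by
  have hd := sideDepth_pos Γ i
  obtain ⟨e, s⟩ := i
  cases s
  · exact ⟨0, left_mem_Icc.2 hd.le, by rw [nhdsWithin_Ioo_eq_nhdsGT hd]; rfl⟩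
  · exact ⟨_, right_mem_Icc.2 hd.le, by rw [nhdsWithin_Ioo_eq_nhdsLT hd]; rfl⟩
  · exact ⟨0, left_mem_Icc.2 hd.le, by rw [nhdsWithin_Ioo_eq_nhdsGT hd]; rfl⟩
  · exact ⟨_, right_mem_Icc.2 hd.le, by rw [nhdsWithin_Ioo_eq_nhdsLT hd]; rfl⟩

lemma sideFilter_neBot (Γ : CompactMetricGraph V E) (i : BVIndex E) : (sideFilter Γ i).NeBot := by
  obtain ⟨p, hp, h⟩ := exists_sideFilter_eq Γ i
  rw [h]
  exact neBot_ae_inf_nhdsWithin_Ioo (sideDepth_pos Γ i) hp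

lemma sideFilter_le_ae (Γ : CompactMetricGraph V E) (i : BVIndex E) :
    sideFilter Γ i ≤ ae (volume.restrict (Ioo 0 (sideDepth Γ i))) := by
  obtain ⟨p, hp, h⟩ := exists_sideFilter_eq Γ i
  rw [h, ae_restrict_eq measurableSet_Ioo]
  exact inf_le_inf_left _ inf_le_right

/-- An almost everywhere property of a cell holds near the side on almost every transversal slice,
in the sense of the essential filter of the side. -/
lemma ae_ae_sidePoint (Γ : CompactMetricGraph V E) (i : BVIndex E) {p : ℝ × ℝ → Prop}
    (h : ∀ᵐ z ∂volume.restrict (Γ.cell i.1), p z) :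
    ∀ᵐ y ∂unitMeasure, ∀ᶠ t in sideFilter Γ i, p (sidePoint Γ i y t) := by
  suffices ∀ᵐ y ∂unitMeasure, ∀ᵐ t ∂volume.restrict (Ioo 0 (sideDepth Γ i)),
      p (sidePoint Γ i y t) from this.mono fun y hy => hy.filter_mono (sideFilter_le_ae Γ i)
  obtain ⟨e, s⟩ := i
  cases s
  · exact ae_unitMeasure_of_ae_Ioo (Γ.length_pos e.2) (ae_ae_rect (ae_rect_swap h))
  · exact ae_unitMeasure_of_ae_Ioo (Γ.length_pos e.2) (ae_ae_rect (ae_rect_swap h))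
  · exact ae_unitMeasure_of_ae_Ioo (Γ.length_pos e.1) (ae_ae_rect h)
  · exact ae_unitMeasure_of_ae_Ioo (Γ.length_pos e.1) (ae_ae_rect h)

lemma isOpen_cell (Γ : CompactMetricGraph V E) (e : E × E) : IsOpen (Γ.cell e) := isOpen_rect _ _

variable [Fintype E] (Γ : CompactMetricGraph V E)

lemma sideSlice_eq (ψ : TwoParticleSpace Γ) (i : BVIndex E) (y t : ℝ) :
    sideSlice Γ ψ i y t = ψ i.1 (sidePoint Γ i y t) := by
  obtain ⟨e, s⟩ := i
  cases s <;> rfl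

lemma exists_isWeakDeriv_normal {ψ : TwoParticleSpace Γ} (hψ : ψ ∈ H1 Γ) (e : E × E) (s : Side) :
    ∃ v, IsWeakDeriv (Γ.cell e) s.normal (ψ e) v := by
  cases s
  exacts [(hψ e).1, (hψ e).1, (hψ e).2, (hψ e).2]

/-- The trace theorem for all four sides. -/
lemma exists_side_trace {ψ : TwoParticleSpace Γ} (hψ : ψ ∈ H1 Γ) (i : BVIndex E) :
    ∃ T : ℝ → ℂ, Measurable T ∧
      (∀ᵐ y ∂unitMeasure, Tendsto (sideSlice Γ ψ i y) (sideFilter Γ i) (𝓝 (T y))) ∧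
      ∀ δ ∈ Ioc 0 (sideDepth Γ i),
        ENNReal.ofReal δ * ∫⁻ y, ‖(Real.sqrt (sideLength Γ i) : ℂ) * T y‖ₑ ^ 2 ∂unitMeasure ≤
          2 * ‖ψ i.1‖ₑ ^ 2 +
            2 * ENNReal.ofReal δ ^ 2 * ‖weakDeriv (Γ.cell i.1) i.2.normal (ψ i.1)‖ₑ ^ 2 := by
  obtain ⟨p, hp, hfilter⟩ := exists_sideFilter_eq Γ i
  rw [hfilter]
  obtain ⟨e, s⟩ := i
  have hw := isWeakDeriv_weakDeriv (exists_isWeakDeriv_normal Γ hψ e s)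
  set v := weakDeriv (Γ.cell e) s.normal (ψ e) with hv
  rw [L2.enorm_sq_eq_lintegral, L2.enorm_sq_eq_lintegral]
  have h1 := Γ.length_pos e.1
  have h2 := Γ.length_pos e.2
  have hemb : MeasurableEmbedding (Prod.swap : ℝ × ℝ → ℝ × ℝ) :=
    MeasurableEquiv.prodComm.measurableEmbedding
  have hswap : ∀ u : L2 (Γ.cell e), IntegrableOn (u ∘ Prod.swap)
      (rect (Γ.length e.2) (Γ.length e.1)) := fun u => by
    rw [← preimage_swap_rect, measurePreserving_swap_plane.integrableOn_comp_preimage hemb]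
    exact integrableOn_rect u
  have hlint : ∀ u : L2 (Γ.cell e), ∫⁻ z in rect (Γ.length e.2) (Γ.length e.1),
      ‖(u ∘ Prod.swap) z‖ₑ ^ 2 = ∫⁻ z in Γ.cell e, ‖u z‖ₑ ^ 2 := fun u => by
    rw [← preimage_swap_rect]
    exact measurePreserving_swap_plane.setLIntegral_comp_preimage_emb hemb
      (fun z => ‖u z‖ₑ ^ 2) _
  have hvertical := fun (hp : p ∈ Icc 0 (Γ.length e.1))
      (hw : IsWeakDeriv (Γ.cell e) (1, 0) (ψ e) v) =>
    HasWeakPartial.exists_unit_trace h1 h2 hp (Lp.stronglyMeasurable (ψ e))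
      (Lp.stronglyMeasurable v) (integrableOn_rect _) (integrableOn_rect _) hw
  have hhorizontal := fun (hp : p ∈ Icc 0 (Γ.length e.2))
      (hw : IsWeakDeriv (Γ.cell e) (0, 1) (ψ e) v) =>
    HasWeakPartial.exists_unit_trace h2 h1 hp
      ((Lp.stronglyMeasurable (ψ e)).comp_measurable measurable_swap)
      ((Lp.stronglyMeasurable v).comp_measurable measurable_swap) (hswap _) (hswap _)
      (HasWeakPartial.comp_swap hw)
  simp only [hlint] at hhorizontal
  cases s
  exacts [hvertical hp hw, hvertical hp hw, hhorizontal hp hw, hhorizontal hp hw]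

lemma ae_tendsto_limUnder {ψ : TwoParticleSpace Γ} (hψ : ψ ∈ H1 Γ) :
    ∀ᵐ y ∂unitMeasure, ∀ i, Tendsto (sideSlice Γ ψ i y) (sideFilter Γ i)
      (𝓝 (limUnder (sideFilter Γ i) (sideSlice Γ ψ i y))) := by
  rw [ae_all_iff]
  intro i
  obtain ⟨T, -, hT, -⟩ := exists_side_trace Γ hψ i
  filter_upwards [hT] with y hy
  exact tendsto_nhds_limUnder ⟨_, hy⟩

lemma exists_boundaryValue_ae_eq {ψ : TwoParticleSpace Γ} (hψ : ψ ∈ H1 Γ) (i : BVIndex E) :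
    ∃ B : ℝ → ℂ, Measurable B ∧ (fun y => boundaryValue Γ ψ y i) =ᵐ[unitMeasure] B ∧
      ∀ δ ∈ Ioc 0 (sideDepth Γ i),
        ENNReal.ofReal δ * ∫⁻ y, ‖B y‖ₑ ^ 2 ∂unitMeasure ≤ 2 * ‖ψ i.1‖ₑ ^ 2 +
          2 * ENNReal.ofReal δ ^ 2 * ‖weakDeriv (Γ.cell i.1) i.2.normal (ψ i.1)‖ₑ ^ 2 := by
  obtain ⟨T, hTm, hT, hle⟩ := exists_side_trace Γ hψ i
  refine ⟨fun y => (Real.sqrt (sideLength Γ i) : ℂ) * T y, hTm.const_mul _, ?_, hle⟩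
  have := sideFilter_neBot Γ i
  filter_upwards [hT] with y hy
  rw [boundaryValue, hy.limUnder_eq]

lemma memLp_boundaryValue {ψ : TwoParticleSpace Γ} (hψ : ψ ∈ H1 Γ) (i : BVIndex E) :
    MemLp (fun y => boundaryValue Γ ψ y i) 2 unitMeasure := by
  obtain ⟨B, hBm, hB, hle⟩ := exists_boundaryValue_ae_eq Γ hψ i
  refine MemLp.ae_eq hB.symm ⟨hBm.aestronglyMeasurable, ?_⟩
  -- finiteness follows from the trace inequality with the largest admissible `δ`
  have hd := sideDepth_pos Γ i
  have h1 := hle _ ⟨hd, le_rfl⟩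
  have h2 := eLpNorm_nnreal_pow_eq_lintegral (μ := unitMeasure) (f := B) (p := 2) two_ne_zero
  simp only [NNReal.coe_ofNat, ENNReal.coe_ofNat, ENNReal.rpow_ofNat] at h2
  by_contra htop
  rw [← h2, not_lt_top_iff.1 htop, ENNReal.top_pow two_ne_zero,
    ENNReal.mul_top (by simpa using hd)] at h1
  exact absurd h1 (not_le.2 (ENNReal.add_lt_top.2 ⟨ENNReal.mul_lt_top (by simp) (by simp),
    ENNReal.mul_lt_top (ENNReal.mul_lt_top (by simp) (by simp)) (by simp)⟩))

/-- The trace inequality. -/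
lemma mul_integral_norm_boundaryValue_sq_le {ψ : TwoParticleSpace Γ} (hψ : ψ ∈ H1 Γ)
    (i : BVIndex E) {δ : ℝ} (hδ : δ ∈ Ioc 0 (sideDepth Γ i)) :
    δ * ∫ y, ‖boundaryValue Γ ψ y i‖ ^ 2 ∂unitMeasure ≤ 2 * ‖ψ i.1‖ ^ 2 +
      2 * δ ^ 2 * ‖weakDeriv (Γ.cell i.1) i.2.normal (ψ i.1)‖ ^ 2 := by
  obtain ⟨B, hBm, hB, hle⟩ := exists_boundaryValue_ae_eq Γ hψ i
  have h1 : ∫ y, ‖boundaryValue Γ ψ y i‖ ^ 2 ∂unitMeasure =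
      (∫⁻ y, ‖B y‖ₑ ^ 2 ∂unitMeasure).toReal := by
    rw [integral_congr_ae (g := fun y => ‖B y‖ ^ 2) (hB.mono fun y hy => by simp only [hy]),
      integral_eq_lintegral_of_nonneg_ae (ae_of_all _ fun y => sq_nonneg _)
        (hBm.norm.pow_const 2).aestronglyMeasurable]
    simp_rw [ENNReal.ofReal_pow (norm_nonneg _), ofReal_norm]
  have h2 := ENNReal.toReal_mono (ENNReal.add_ne_top.2
    ⟨ENNReal.mul_ne_top (by simp) (by simp),
      ENNReal.mul_ne_top (ENNReal.mul_ne_top (by simp) (by simp)) (by simp)⟩) (hle δ hδ)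
  rw [ENNReal.toReal_add (ENNReal.mul_ne_top (by simp) (by simp))
    (ENNReal.mul_ne_top (ENNReal.mul_ne_top (by simp) (by simp)) (by simp))] at h2
  simpa [h1, ENNReal.toReal_mul, ENNReal.toReal_ofReal hδ.1.le] using h2

lemma H1_add {φ ψ : TwoParticleSpace Γ} (hφ : φ ∈ H1 Γ) (hψ : ψ ∈ H1 Γ) : φ + ψ ∈ H1 Γ := by
  intro e
  obtain ⟨⟨v1, h1⟩, ⟨v2, h2⟩⟩ := hφ e
  obtain ⟨⟨w1, k1⟩, ⟨w2, k2⟩⟩ := hψ e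
  exact ⟨⟨_, h1.add k1⟩, ⟨_, h2.add k2⟩⟩

lemma H1_smul (c : ℂ) {ψ : TwoParticleSpace Γ} (hψ : ψ ∈ H1 Γ) : c • ψ ∈ H1 Γ := by
  intro e
  obtain ⟨⟨v1, h1⟩, ⟨v2, h2⟩⟩ := hψ e
  exact ⟨⟨_, h1.smul c⟩, ⟨_, h2.smul c⟩⟩

lemma H1_zero : (0 : TwoParticleSpace Γ) ∈ H1 Γ :=
  fun _ => ⟨⟨_, isWeakDeriv_zero⟩, ⟨_, isWeakDeriv_zero⟩⟩

lemma boundaryValue_add_ae {φ ψ : TwoParticleSpace Γ} (hφ : φ ∈ H1 Γ) (hψ : ψ ∈ H1 Γ) :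
    ∀ᵐ y ∂unitMeasure, boundaryValue Γ (φ + ψ) y = boundaryValue Γ φ y + boundaryValue Γ ψ y := by
  have hslice : ∀ i : BVIndex E, ∀ᵐ y ∂unitMeasure, ∀ᶠ t in sideFilter Γ i,
      sideSlice Γ φ i y t + sideSlice Γ ψ i y t = sideSlice Γ (φ + ψ) i y t := fun i => by
    simp only [sideSlice_eq]
    exact ae_ae_sidePoint Γ i (p := fun z => φ i.1 z + ψ i.1 z = (φ + ψ) i.1 z)
      ((Lp.coeFn_add (φ i.1) (ψ i.1)).mono fun z hz => hz.symm)
  filter_upwards [ae_all_iff.2 hslice, ae_tendsto_limUnder Γ hφ, ae_tendsto_limUnder Γ hψ]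
    with y hy h1 h2
  ext i
  have := sideFilter_neBot Γ i
  have h3 := ((h1 i).add (h2 i)).congr' (hy i)
  simp only [boundaryValue, Pi.add_apply, h3.limUnder_eq, mul_add]

lemma boundaryValue_smul_ae (c : ℂ) {ψ : TwoParticleSpace Γ} (hψ : ψ ∈ H1 Γ) :
    ∀ᵐ y ∂unitMeasure, boundaryValue Γ (c • ψ) y = c • boundaryValue Γ ψ y := by
  have hslice : ∀ i : BVIndex E, ∀ᵐ y ∂unitMeasure, ∀ᶠ t in sideFilter Γ i,
      c * sideSlice Γ ψ i y t = sideSlice Γ (c • ψ) i y t := fun i => by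
    simp only [sideSlice_eq]
    exact ae_ae_sidePoint Γ i (p := fun z => c * ψ i.1 z = (c • ψ) i.1 z)
      ((Lp.coeFn_smul c (ψ i.1)).mono fun z hz => hz.symm)
  filter_upwards [ae_all_iff.2 hslice, ae_tendsto_limUnder Γ hψ] with y hy h1
  ext i
  have := sideFilter_neBot Γ i
  have h3 := ((h1 i).const_mul c).congr' (hy i)
  simp only [boundaryValue, Pi.smul_apply, h3.limUnder_eq, smul_eq_mul]
  ring

end Sides

/-! ### The boundary term and the energy -/

section Matrices

variable {ι : Type*}

lemma IsBoundedMeasurable.exists_bound {A : ℝ → Matrix ι ι ℂ} (hA : IsBoundedMeasurable A) :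
    ∃ C : ℝ, 0 ≤ C ∧ ∀ᵐ y ∂unitMeasure, ∀ i j, ‖A y i j‖ ≤ C := by
  obtain ⟨C, hC⟩ := hA.2
  exact ⟨|C|, abs_nonneg C, hC.mono fun y h i j => (h i j).trans (le_abs_self C)⟩

variable [Fintype ι]

lemma IsBoundedMeasurable.memLp_mulVec {A : ℝ → Matrix ι ι ℂ} (hA : IsBoundedMeasurable A)
    {b : ℝ → ι → ℂ} (hb : ∀ i, MemLp (fun y => b y i) 2 unitMeasure) (i : ι) :
    MemLp (fun y => (A y *ᵥ b y) i) 2 unitMeasure := by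
  obtain ⟨C, -, hC⟩ := hA.exists_bound
  refine memLp_finsetSum' (f := fun j y => A y i j * b y j) Finset.univ (fun j _ => ?_) |>.ae_eq
    (ae_of_all _ fun y => by simp [Matrix.mulVec, dotProduct])
  refine (hb j).of_le_mul (c := C) ((hA.1 i j).aestronglyMeasurable.mul (hb j).1) ?_
  filter_upwards [hC] with y hy
  rw [norm_mul]
  gcongr
  exact hy i j

lemma norm_mulVec_apply_le {C : ℝ} {A : Matrix ι ι ℂ} (hA : ∀ i j, ‖A i j‖ ≤ C) (v : ι → ℂ)
    (i : ι) : ‖(A *ᵥ v) i‖ ≤ C * ∑ j, ‖v j‖ := by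
  rw [Matrix.mulVec, dotProduct, Finset.mul_sum]
  refine norm_sum_le_of_le _ fun j _ => ?_
  rw [norm_mul]
  gcongr
  exact hA i j

lemma sq_sum_norm_le (v : ι → ℂ) :
    (∑ j, ‖v j‖) ^ 2 ≤ Fintype.card ι * ∑ j, ‖v j‖ ^ 2 := by
  simpa using sq_sum_le_card_mul_sum_sq (s := Finset.univ) (f := fun j => ‖v j‖)

lemma norm_star_dotProduct_mulVec_le {C : ℝ} {A : Matrix ι ι ℂ} (hC : 0 ≤ C)
    (hA : ∀ i j, ‖A i j‖ ≤ C) (v : ι → ℂ) :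
    ‖star v ⬝ᵥ (A *ᵥ v)‖ ≤ C * Fintype.card ι * ∑ j, ‖v j‖ ^ 2 := by
  calc ‖star v ⬝ᵥ (A *ᵥ v)‖ ≤ ∑ i, ‖v i‖ * (C * ∑ j, ‖v j‖) := by
        refine norm_sum_le_of_le _ fun i _ => ?_
        rw [norm_mul, Pi.star_apply, norm_star]
        gcongr
        exact norm_mulVec_apply_le hA v i
    _ = C * (∑ j, ‖v j‖) ^ 2 := by rw [← Finset.sum_mul]; ring
    _ ≤ C * (Fintype.card ι * ∑ j, ‖v j‖ ^ 2) := by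
        gcongr
        exact sq_sum_norm_le v
    _ = _ := by ring

lemma IsBoundedMeasurable.integrable_star_dotProduct_mulVec {A : ℝ → Matrix ι ι ℂ}
    (hA : IsBoundedMeasurable A) {b b' : ℝ → ι → ℂ}
    (hb : ∀ i, MemLp (fun y => b y i) 2 unitMeasure)
    (hb' : ∀ i, MemLp (fun y => b' y i) 2 unitMeasure) :
    Integrable (fun y => star (b y) ⬝ᵥ (A y *ᵥ b' y)) unitMeasure := by
  refine integrable_finsetSum _ fun i _ => ?_
  exact (hb i).star.integrable_mul (hA.memLp_mulVec hb' i)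

end Matrices

section Energy

variable {V E : Type*} [Fintype E] (Γ : CompactMetricGraph V E)

/-- The kinetic energy `‖∇ψ‖²`. -/
noncomputable def energy (ψ : TwoParticleSpace Γ) : ℝ :=
  ∑ e : E × E, (‖weakDeriv (Γ.cell e) (1, 0) (ψ e)‖ ^ 2 +
    ‖weakDeriv (Γ.cell e) (0, 1) (ψ e)‖ ^ 2)

/-- The squared `L²`-norm of the boundary values. -/
noncomputable def boundaryNormSq (ψ : TwoParticleSpace Γ) : ℝ :=
  ∑ i : BVIndex E, ∫ y, ‖boundaryValue Γ ψ y i‖ ^ 2 ∂unitMeasure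

lemma energy_nonneg (ψ : TwoParticleSpace Γ) : 0 ≤ energy Γ ψ :=
  Finset.sum_nonneg fun _ _ => by positivity

lemma boundaryNormSq_nonneg (ψ : TwoParticleSpace Γ) : 0 ≤ boundaryNormSq Γ ψ :=
  Finset.sum_nonneg fun _ _ => integral_nonneg fun _ => sq_nonneg _

lemma integrable_norm_boundaryValue_sq {ψ : TwoParticleSpace Γ} (hψ : ψ ∈ H1 Γ) (i : BVIndex E) :
    Integrable (fun y => ‖boundaryValue Γ ψ y i‖ ^ 2) unitMeasure :=
  (memLp_boundaryValue Γ hψ i).integrable_norm_pow two_ne_zero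

/-- The boundary values are form-bounded with respect to the energy with arbitrarily small
relative bound. -/
lemma exists_boundaryNormSq_le {η : ℝ} (hη : 0 < η) :
    ∃ K : ℝ, 0 ≤ K ∧ ∀ ψ ∈ H1 Γ, boundaryNormSq Γ ψ ≤ η * energy Γ ψ + K * ‖ψ‖ ^ 2 := by
  obtain ⟨d, hd0, hd⟩ : ∃ d > 0, ∀ i, d ≤ sideDepth Γ i := by
    rcases isEmpty_or_nonempty (BVIndex E) with h | h
    · exact ⟨1, one_pos, fun i => h.elim i⟩
    · obtain ⟨i, hi⟩ := Finite.exists_min (sideDepth Γ)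
      exact ⟨_, sideDepth_pos Γ i, hi⟩
  set m : ℝ := ((Fintype.card Side : ℕ) : ℝ) with hm
  have hm0 : 0 < m := by
    have : Nonempty Side := ⟨Side.left⟩
    exact Nat.cast_pos.2 Fintype.card_pos
  -- summing the trace inequality over the `m` sides gives the factor `2 δ m` of the energy
  set δ := min d (η / (2 * m)) with hδ
  have hδ0 : 0 < δ := lt_min hd0 (by positivity)
  have hδη : 2 * m * δ ≤ η := by
    have := min_le_right d (η / (2 * m))
    rw [← hδ, le_div_iff₀ (by positivity)] at this
    linarith
  refine ⟨m * (2 / δ), by positivity, fun ψ hψ => ?_⟩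
  have hside : ∀ i : BVIndex E, ∫ y, ‖boundaryValue Γ ψ y i‖ ^ 2 ∂unitMeasure ≤
      2 / δ * ‖ψ i.1‖ ^ 2 + 2 * δ * (‖weakDeriv (Γ.cell i.1) (1, 0) (ψ i.1)‖ ^ 2 +
        ‖weakDeriv (Γ.cell i.1) (0, 1) (ψ i.1)‖ ^ 2) := by
    intro i
    have h1 := mul_integral_norm_boundaryValue_sq_le Γ hψ i
      ⟨hδ0, (min_le_left _ _).trans (hd i)⟩
    have h2 : ‖weakDeriv (Γ.cell i.1) i.2.normal (ψ i.1)‖ ^ 2 ≤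
        ‖weakDeriv (Γ.cell i.1) (1, 0) (ψ i.1)‖ ^ 2 +
          ‖weakDeriv (Γ.cell i.1) (0, 1) (ψ i.1)‖ ^ 2 := by
      obtain ⟨e, s⟩ := i
      cases s <;> simp [Side.normal]
    refine le_of_mul_le_mul_left (h1.trans ?_) hδ0
    rw [mul_add, ← mul_assoc, mul_div_cancel₀ _ hδ0.ne']
    nlinarith [mul_le_mul_of_nonneg_left h2 (by positivity : 0 ≤ 2 * δ ^ 2)]
  have hnorm : ‖ψ‖ ^ 2 = ∑ e, ‖ψ e‖ ^ 2 := PiLp.norm_sq_eq_of_L2 _ ψ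
  calc boundaryNormSq Γ ψ ≤ ∑ i : BVIndex E, (2 / δ * ‖ψ i.1‖ ^ 2 +
        2 * δ * (‖weakDeriv (Γ.cell i.1) (1, 0) (ψ i.1)‖ ^ 2 +
          ‖weakDeriv (Γ.cell i.1) (0, 1) (ψ i.1)‖ ^ 2)) := Finset.sum_le_sum fun i _ => hside i
    _ = m * (2 / δ) * ‖ψ‖ ^ 2 + 2 * m * δ * energy Γ ψ := by
        rw [Fintype.sum_prod_type, hnorm, energy]
        rw [Finset.mul_sum, Finset.mul_sum, ← Finset.sum_add_distrib]
        refine Finset.sum_congr rfl fun e _ => (Finset.sum_const (2 / δ * ‖ψ e‖ ^ 2 +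
          2 * δ * (‖weakDeriv (Γ.cell e) (1, 0) (ψ e)‖ ^ 2 +
            ‖weakDeriv (Γ.cell e) (0, 1) (ψ e)‖ ^ 2))).trans ?_
        rw [Finset.card_univ, nsmul_eq_mul, ← hm]
        ring
    _ ≤ _ := by
        rw [add_comm]
        gcongr
        exact energy_nonneg Γ ψ

variable {L : ℝ → Matrix (BVIndex E) (BVIndex E) ℂ}

lemma twoParticleForm_self (L : ℝ → Matrix (BVIndex E) (BVIndex E) ℂ) (ψ : TwoParticleSpace Γ) :
    twoParticleForm Γ L ψ ψ = (energy Γ ψ : ℂ) -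
      ∫ y, star (boundaryValue Γ ψ y) ⬝ᵥ (L y *ᵥ boundaryValue Γ ψ y) ∂unitMeasure := by
  rw [twoParticleForm, energy]
  simp only [inner_self_eq_norm_sq_to_K]
  push_cast
  rfl

lemma exists_norm_boundaryTerm_le (hL : IsBoundedMeasurable L) :
    ∃ M : ℝ, 0 ≤ M ∧ ∀ ψ ∈ H1 Γ,
      ‖∫ y, star (boundaryValue Γ ψ y) ⬝ᵥ (L y *ᵥ boundaryValue Γ ψ y) ∂unitMeasure‖ ≤
        M * boundaryNormSq Γ ψ := by
  obtain ⟨C, hC0, hC⟩ := hL.exists_bound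
  refine ⟨C * Fintype.card (BVIndex E), by positivity, fun ψ hψ => ?_⟩
  have hint := fun i (_ : i ∈ Finset.univ) => integrable_norm_boundaryValue_sq Γ hψ i
  rw [boundaryNormSq, ← integral_finsetSum _ hint, ← integral_const_mul]
  refine norm_integral_le_of_norm_le ((integrable_finsetSum _ hint).const_mul _) ?_
  filter_upwards [hC] with y hy
  exact norm_star_dotProduct_mulVec_le hC0 hy _

/-- Gårding's inequality: the form controls half of the energy up to the `L²`-norm, with no boundary
condition imposed. -/
lemma exists_half_energy_le (hL : IsBoundedMeasurable L) :
    ∃ K : ℝ, 0 ≤ K ∧ ∀ ψ ∈ H1 Γ,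
      energy Γ ψ / 2 - K * ‖ψ‖ ^ 2 ≤ (twoParticleForm Γ L ψ ψ).re := by
  obtain ⟨M, hM0, hM⟩ := exists_norm_boundaryTerm_le Γ hL
  obtain ⟨K, hK0, hK⟩ := exists_boundaryNormSq_le Γ (η := 1 / (2 * (M + 1))) (by positivity)
  refine ⟨M * K, by positivity, fun ψ hψ => ?_⟩
  rw [twoParticleForm_self, Complex.sub_re, Complex.ofReal_re]
  have h1 := (Complex.re_le_norm _).trans (hM ψ hψ)
  have h2 := mul_le_mul_of_nonneg_left (hK ψ hψ) hM0
  have h3 : M * (1 / (2 * (M + 1)) * energy Γ ψ) ≤ energy Γ ψ / 2 := by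
    have h4 : M * (1 / (2 * (M + 1))) ≤ 1 / 2 := by
      rw [mul_one_div, div_le_div_iff₀ (by positivity) two_pos]; linarith
    nlinarith [mul_le_mul_of_nonneg_right h4 (energy_nonneg Γ ψ)]
  linarith

lemma exists_norm_twoParticleForm_le (hL : IsBoundedMeasurable L) :
    ∃ M : ℝ, ∀ ψ ∈ H1 Γ,
      ‖twoParticleForm Γ L ψ ψ‖ ≤ energy Γ ψ + M * boundaryNormSq Γ ψ := by
  obtain ⟨M, -, hM⟩ := exists_norm_boundaryTerm_le Γ hL
  refine ⟨M, fun ψ hψ => ?_⟩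
  rw [twoParticleForm_self]
  refine (norm_sub_le _ _).trans (add_le_add (le_of_eq ?_) (hM ψ hψ))
  rw [Complex.norm_real, Real.norm_of_nonneg (energy_nonneg Γ ψ)]

end Energy

/-! ### Hermitian symmetry and closedness of the form -/

section Form

variable {V E : Type*} [Fintype E] (Γ : CompactMetricGraph V E)

lemma weakDeriv_normal_add {φ ψ : TwoParticleSpace Γ} (hφ : φ ∈ H1 Γ) (hψ : ψ ∈ H1 Γ)
    (e : E × E) (s : Side) :
    weakDeriv (Γ.cell e) s.normal ((φ + ψ) e) =
      weakDeriv (Γ.cell e) s.normal (φ e) + weakDeriv (Γ.cell e) s.normal (ψ e) :=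
  ((isWeakDeriv_weakDeriv (exists_isWeakDeriv_normal Γ hφ e s)).add
    (isWeakDeriv_weakDeriv (exists_isWeakDeriv_normal Γ hψ e s))).weakDeriv_eq (isOpen_cell Γ e)

lemma weakDeriv_normal_smul (c : ℂ) {ψ : TwoParticleSpace Γ} (hψ : ψ ∈ H1 Γ)
    (e : E × E) (s : Side) :
    weakDeriv (Γ.cell e) s.normal ((c • ψ) e) = c • weakDeriv (Γ.cell e) s.normal (ψ e) :=
  ((isWeakDeriv_weakDeriv (exists_isWeakDeriv_normal Γ hψ e s)).smul c).weakDeriv_eq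
    (isOpen_cell Γ e)

lemma H1_sub {φ ψ : TwoParticleSpace Γ} (hφ : φ ∈ H1 Γ) (hψ : ψ ∈ H1 Γ) : φ - ψ ∈ H1 Γ := by
  rw [sub_eq_add_neg, ← neg_one_smul ℂ ψ]
  exact H1_add Γ hφ (H1_smul Γ _ hψ)

lemma weakDeriv_normal_sub {φ ψ : TwoParticleSpace Γ} (hφ : φ ∈ H1 Γ) (hψ : ψ ∈ H1 Γ)
    (e : E × E) (s : Side) :
    weakDeriv (Γ.cell e) s.normal ((φ - ψ) e) =
      weakDeriv (Γ.cell e) s.normal (φ e) - weakDeriv (Γ.cell e) s.normal (ψ e) := by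
  rw [sub_eq_add_neg, ← neg_one_smul ℂ ψ, weakDeriv_normal_add Γ hφ (H1_smul Γ _ hψ),
    weakDeriv_normal_smul Γ _ hψ, neg_one_smul, sub_eq_add_neg]

lemma boundaryValue_sub_ae {φ ψ : TwoParticleSpace Γ} (hφ : φ ∈ H1 Γ) (hψ : ψ ∈ H1 Γ) :
    ∀ᵐ y ∂unitMeasure, boundaryValue Γ (φ - ψ) y = boundaryValue Γ φ y - boundaryValue Γ ψ y := by
  filter_upwards [boundaryValue_add_ae Γ hφ (H1_smul Γ (-1) hψ), boundaryValue_smul_ae Γ (-1) hψ]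
    with y h1 h2
  rw [sub_eq_add_neg, ← neg_one_smul ℂ ψ, h1, h2, neg_one_smul, sub_eq_add_neg]

lemma weakDeriv_sq_le_energy (ψ : TwoParticleSpace Γ) (e : E × E) (s : Side) :
    ‖weakDeriv (Γ.cell e) s.normal (ψ e)‖ ^ 2 ≤ energy Γ ψ := by
  refine le_trans ?_ (Finset.single_le_sum (fun _ _ => by positivity) (Finset.mem_univ e))
  cases s <;> simp [Side.normal]

variable {P L : ℝ → Matrix (BVIndex E) (BVIndex E) ℂ}

lemma isHermitianFormOn_twoParticleForm (hL : IsBoundedMeasurable L)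
    (hself : ∀ᵐ y ∂unitMeasure, IsSelfAdjointOnKer (P y) (L y)) :
    IsHermitianFormOn (formDomain Γ P) (twoParticleForm Γ L) where
  zero_mem := by
    refine ⟨H1_zero Γ, ?_⟩
    filter_upwards [boundaryValue_smul_ae Γ 0 (H1_zero Γ)] with y hy
    rw [zero_smul, zero_smul] at hy
    rw [hy, Matrix.mulVec_zero]
  add_mem φ hφ ψ hψ := by
    refine ⟨H1_add Γ hφ.1 hψ.1, ?_⟩
    filter_upwards [boundaryValue_add_ae Γ hφ.1 hψ.1, hφ.2, hψ.2] with y hy h1 h2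
    rw [hy, Matrix.mulVec_add, h1, h2, add_zero]
  smul_mem c ψ hψ := by
    refine ⟨H1_smul Γ c hψ.1, ?_⟩
    filter_upwards [boundaryValue_smul_ae Γ c hψ.1, hψ.2] with y hy h1
    rw [hy, Matrix.mulVec_smul, h1, smul_zero]
  add_right φ hφ ψ hψ χ hχ := by
    have hint : ∫ y, star (boundaryValue Γ φ y) ⬝ᵥ (L y *ᵥ boundaryValue Γ (ψ + χ) y)
        ∂unitMeasure =
        ∫ y, star (boundaryValue Γ φ y) ⬝ᵥ (L y *ᵥ boundaryValue Γ ψ y) ∂unitMeasure +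
        ∫ y, star (boundaryValue Γ φ y) ⬝ᵥ (L y *ᵥ boundaryValue Γ χ y) ∂unitMeasure := by
      rw [← integral_add
        (hL.integrable_star_dotProduct_mulVec (memLp_boundaryValue Γ hφ.1)
          (memLp_boundaryValue Γ hψ.1))
        (hL.integrable_star_dotProduct_mulVec (memLp_boundaryValue Γ hφ.1)
          (memLp_boundaryValue Γ hχ.1))]
      refine integral_congr_ae ?_
      filter_upwards [boundaryValue_add_ae Γ hψ.1 hχ.1] with y hy
      rw [hy, Matrix.mulVec_add, dotProduct_add]
    have hx := fun e => weakDeriv_normal_add Γ hψ.1 hχ.1 e .left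
    have hy := fun e => weakDeriv_normal_add Γ hψ.1 hχ.1 e .bottom
    simp only [Side.normal] at hx hy
    simp only [twoParticleForm, hint, hx, hy, inner_add_right, Finset.sum_add_distrib]
    ring
  smul_right c φ hφ ψ hψ := by
    have hint : ∫ y, star (boundaryValue Γ φ y) ⬝ᵥ (L y *ᵥ boundaryValue Γ (c • ψ) y)
        ∂unitMeasure =
        c * ∫ y, star (boundaryValue Γ φ y) ⬝ᵥ (L y *ᵥ boundaryValue Γ ψ y) ∂unitMeasure := by
      rw [← integral_const_mul]
      refine integral_congr_ae ?_
      filter_upwards [boundaryValue_smul_ae Γ c hψ.1] with y hy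
      rw [hy, Matrix.mulVec_smul, dotProduct_smul, smul_eq_mul]
    have hx := fun e => weakDeriv_normal_smul Γ c hψ.1 e .left
    have hy := fun e => weakDeriv_normal_smul Γ c hψ.1 e .bottom
    simp only [Side.normal] at hx hy
    simp only [twoParticleForm, hint, hx, hy, inner_smul_right, ← mul_add, ← Finset.mul_sum,
      mul_sub]
  conj_symm φ hφ ψ hψ := by
    have hint : ∫ y, star (boundaryValue Γ ψ y) ⬝ᵥ (L y *ᵥ boundaryValue Γ φ y) ∂unitMeasure =
        conj (∫ y, star (boundaryValue Γ φ y) ⬝ᵥ (L y *ᵥ boundaryValue Γ ψ y) ∂unitMeasure) := by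
      rw [← integral_conj]
      refine integral_congr_ae ?_
      filter_upwards [hself, hφ.2, hψ.2] with y hy h1 h2
      rw [hy.2 _ _ h2 h1, starRingEnd_apply, Matrix.star_dotProduct]
    simp only [twoParticleForm, hint, map_sub, map_sum, map_add, inner_conj_symm]

lemma isSemibounded_twoParticleForm (hL : IsBoundedMeasurable L) :
    IsSemibounded (formDomain Γ P) (twoParticleForm Γ L) := by
  obtain ⟨K, -, hK⟩ := exists_half_energy_le Γ hL
  refine ⟨-K, fun ψ hψ => le_trans ?_ (hK ψ hψ.1)⟩
  linarith [energy_nonneg Γ ψ]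

/-- The Sobolev space is complete: an `L²`-convergent sequence that is Cauchy for the energy
converges in energy to an element of `H¹`. -/
lemma mem_H1_and_tendsto_energy {u : ℕ → TwoParticleSpace Γ} {ψ : TwoParticleSpace Γ}
    (hu : ∀ n, u n ∈ H1 Γ) (hlim : Tendsto u atTop (𝓝 ψ))
    (hcauchy : Tendsto (fun p : ℕ × ℕ => energy Γ (u p.1 - u p.2)) atTop (𝓝 0)) :
    ψ ∈ H1 Γ ∧ Tendsto (fun n => energy Γ (u n - ψ)) atTop (𝓝 0) := by
  have hex : ∀ (e : E × E) (s : Side), ∃ v,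
      Tendsto (fun n => weakDeriv (Γ.cell e) s.normal (u n e)) atTop (𝓝 v) := by
    intro e s
    refine cauchySeq_tendsto_of_complete ?_
    rw [cauchySeq_iff_tendsto_dist_atTop_0]
    have hsqrt : Tendsto (fun p : ℕ × ℕ => Real.sqrt (energy Γ (u p.1 - u p.2))) atTop (𝓝 0) := by
      simpa using hcauchy.sqrt
    refine squeeze_zero (fun _ => dist_nonneg) (fun p => ?_) hsqrt
    rw [dist_eq_norm, ← weakDeriv_normal_sub Γ (hu _) (hu _)]
    exact Real.le_sqrt_of_sq_le (weakDeriv_sq_le_energy Γ _ e s)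
  have hcomp : ∀ e, Tendsto (fun n => u n e) atTop (𝓝 (ψ e)) := fun e =>
    ((PiLp.continuous_apply 2 _ e).tendsto ψ).comp hlim
  have hweak : ∀ (e : E × E) (s : Side), ∃ v,
      Tendsto (fun n => weakDeriv (Γ.cell e) s.normal (u n e)) atTop (𝓝 v) ∧
        IsWeakDeriv (Γ.cell e) s.normal (ψ e) v := by
    intro e s
    obtain ⟨v, hv⟩ := hex e s
    exact ⟨v, hv, IsWeakDeriv.of_tendsto
      (fun n => isWeakDeriv_weakDeriv (exists_isWeakDeriv_normal Γ (hu n) e s)) (hcomp e) hv⟩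
  have hψ : ψ ∈ H1 Γ := fun e =>
    ⟨(hweak e .left).imp fun v hv => hv.2, (hweak e .bottom).imp fun v hv => hv.2⟩
  refine ⟨hψ, ?_⟩
  have hterm : ∀ (e : E × E) (s : Side),
      Tendsto (fun n => ‖weakDeriv (Γ.cell e) s.normal ((u n - ψ) e)‖ ^ 2) atTop (𝓝 0) := by
    intro e s
    obtain ⟨v, hv, hw⟩ := hweak e s
    simp only [weakDeriv_normal_sub Γ (hu _) hψ, hw.weakDeriv_eq (isOpen_cell Γ e)]
    simpa using ((hv.sub_const v).norm.pow 2)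
  have := tendsto_finsetSum Finset.univ fun e (_ : e ∈ Finset.univ) =>
    (hterm e .left).add (hterm e .bottom)
  simpa [energy, Side.normal] using this

lemma tendsto_boundaryNormSq {u : ℕ → TwoParticleSpace Γ} (hu : ∀ n, u n ∈ H1 Γ)
    (hnorm : Tendsto u atTop (𝓝 0)) (henergy : Tendsto (fun n => energy Γ (u n)) atTop (𝓝 0)) :
    Tendsto (fun n => boundaryNormSq Γ (u n)) atTop (𝓝 0) := by
  obtain ⟨K, -, hK⟩ := exists_boundaryNormSq_le Γ one_pos
  refine squeeze_zero (fun n => boundaryNormSq_nonneg Γ _) (fun n => hK _ (hu n)) ?_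
  simpa using (henergy.const_mul 1).add ((hnorm.norm.pow 2).const_mul K)

/-- The boundary condition survives limits in `L²` of the boundary values. -/
lemma ae_mulVec_boundaryValue_eq_zero (hP : IsBoundedMeasurable P) {u : ℕ → TwoParticleSpace Γ}
    {ψ : TwoParticleSpace Γ} (hu : ∀ n, u n ∈ formDomain Γ P) (hψ : ψ ∈ H1 Γ)
    (hlim : Tendsto (fun n => boundaryNormSq Γ (u n - ψ)) atTop (𝓝 0)) :
    ∀ᵐ y ∂unitMeasure, P y *ᵥ boundaryValue Γ ψ y = 0 := by
  obtain ⟨C, hC0, hC⟩ := hP.exists_bound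
  have hLp := hP.memLp_mulVec (memLp_boundaryValue Γ hψ)
  suffices ∀ i, ∀ᵐ y ∂unitMeasure, (P y *ᵥ boundaryValue Γ ψ y) i = 0 from
    (ae_all_iff.2 this).mono fun y hy => funext hy
  intro i
  have hle : ∀ n, ∫ y, ‖(P y *ᵥ boundaryValue Γ ψ y) i‖ ^ 2 ∂unitMeasure ≤
      C ^ 2 * Fintype.card (BVIndex E) * boundaryNormSq Γ (u n - ψ) := by
    intro n
    have hint := fun j (_ : j ∈ Finset.univ) =>
      integrable_norm_boundaryValue_sq Γ (H1_sub Γ (hu n).1 hψ) j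
    rw [boundaryNormSq, ← integral_finsetSum _ hint, ← integral_const_mul]
    refine integral_mono_ae ((hLp i).integrable_norm_pow two_ne_zero)
      ((integrable_finsetSum _ hint).const_mul _) ?_
    filter_upwards [hC, (hu n).2, boundaryValue_sub_ae Γ (hu n).1 hψ] with y h1 h2 h3
    have h4 : P y *ᵥ boundaryValue Γ ψ y = -(P y *ᵥ boundaryValue Γ (u n - ψ) y) := by
      rw [h3, Matrix.mulVec_sub, h2, zero_sub, neg_neg]
    calc ‖(P y *ᵥ boundaryValue Γ ψ y) i‖ ^ 2
        ≤ (C * ∑ j, ‖boundaryValue Γ (u n - ψ) y j‖) ^ 2 := by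
          rw [h4, Pi.neg_apply, norm_neg]
          gcongr
          exact norm_mulVec_apply_le h1 _ i
      _ ≤ C ^ 2 * (Fintype.card (BVIndex E) * ∑ j, ‖boundaryValue Γ (u n - ψ) y j‖ ^ 2) := by
          rw [mul_pow]
          gcongr
          exact sq_sum_norm_le _
      _ = _ := by ring
  have hzero : ∫ y, ‖(P y *ᵥ boundaryValue Γ ψ y) i‖ ^ 2 ∂unitMeasure = 0 := by
    have hlim' := hlim.const_mul (C ^ 2 * Fintype.card (BVIndex E))
    rw [mul_zero] at hlim'
    exact le_antisymm (ge_of_tendsto' hlim' hle) (integral_nonneg fun _ => sq_nonneg _)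
  rw [integral_eq_zero_iff_of_nonneg (fun _ => sq_nonneg _)
    ((hLp i).integrable_norm_pow two_ne_zero)] at hzero
  filter_upwards [hzero] with y hy
  simpa using hy

lemma isClosedForm_twoParticleForm (hP : IsBoundedMeasurable P) (hL : IsBoundedMeasurable L) :
    IsClosedForm (formDomain Γ P) (twoParticleForm Γ L) := by
  intro u ψ hu hlim hform
  obtain ⟨K, -, hK⟩ := exists_half_energy_le Γ hL
  have hsub : Tendsto (fun p : ℕ × ℕ => u p.1 - u p.2) atTop (𝓝 0) := by
    rw [← prod_atTop_atTop_eq]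
    simpa using (hlim.comp tendsto_fst).sub (hlim.comp tendsto_snd)
  have hcauchy : Tendsto (fun p : ℕ × ℕ => energy Γ (u p.1 - u p.2)) atTop (𝓝 0) := by
    refine squeeze_zero (fun p => energy_nonneg Γ _)
      (g := fun p : ℕ × ℕ => 2 * (‖twoParticleForm Γ L (u p.1 - u p.2) (u p.1 - u p.2)‖ +
        K * ‖u p.1 - u p.2‖ ^ 2)) (fun p => ?_) ?_
    · have h1 := hK _ (H1_sub Γ (hu p.1).1 (hu p.2).1)
      have h2 := Complex.re_le_norm (twoParticleForm Γ L (u p.1 - u p.2) (u p.1 - u p.2))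
      linarith
    · simpa using (hform.norm.add ((hsub.norm.pow 2).const_mul K)).const_mul 2
  obtain ⟨hψ, henergy⟩ := mem_H1_and_tendsto_energy Γ (fun n => (hu n).1) hlim hcauchy
  have hmem : ∀ n, u n - ψ ∈ H1 Γ := fun n => H1_sub Γ (hu n).1 hψ
  have hbv : Tendsto (fun n => boundaryNormSq Γ (u n - ψ)) atTop (𝓝 0) :=
    tendsto_boundaryNormSq Γ hmem (by simpa using hlim.sub_const ψ) henergy
  refine ⟨⟨hψ, ae_mulVec_boundaryValue_eq_zero Γ hP hu hψ hbv⟩, ?_⟩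
  obtain ⟨M, hM⟩ := exists_norm_twoParticleForm_le Γ hL
  refine squeeze_zero_norm (fun n => hM _ (hmem n)) ?_
  simpa using henergy.add (hbv.const_mul M)

end Form

theorem mainTheorem2 {V E : Type*} [Finite V] [Fintype E] (Γ : CompactMetricGraph V E)
    (P L : ℝ → Matrix (BVIndex E) (BVIndex E) ℂ)
    (hP : IsBoundedMeasurable P) (hL : IsBoundedMeasurable L)
    (hproj : ∀ᵐ y ∂unitMeasure, IsStarProjection (P y))
    (hself : ∀ᵐ y ∂unitMeasure, IsSelfAdjointOnKer (P y) (L y)) :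
    (∀ ψ ∈ H1 Γ, (∀ᵐ y ∂unitMeasure, HasBoundaryValues Γ ψ y) ∧
      ∀ i, MemLp (fun y => boundaryValue Γ ψ y i) 2 unitMeasure) ∧
    IsHermitianFormOn (formDomain Γ P) (twoParticleForm Γ L) ∧
    IsSemibounded (formDomain Γ P) (twoParticleForm Γ L) ∧
    IsClosedForm (formDomain Γ P) (twoParticleForm Γ L) :=
  ⟨fun _ hψ => ⟨(ae_tendsto_limUnder Γ hψ).mono fun _ h i => ⟨_, h i⟩, memLp_boundaryValue Γ hψ⟩,
    isHermitianFormOn_twoParticleForm Γ hL hself, isSemibounded_twoParticleForm Γ hL,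
    isClosedForm_twoParticleForm Γ hP hL⟩
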